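/- Let $\mathscr S$ be the class of compactly generated locally compact groups that are totally disconnected, topologically simple and non-discrete, and let $G\in\mathscr S$. A subgroup of $G$ is locally normal if it is compact and its normaliser is open. The structure lattice $\mathcal{LN}(G)$ is the set of locally normal subgroups modulo commensurability, with the partial order induced by inclusion of locally normal subgroups; its minimum $0$ is the class of the trivial subgroup and its maximum $\infty$ is the class of the compact open subgroups. For $\alpha\in\mathcal{LN}(G)$, let $\alpha^\perp$ be the commensurability class of the centraliser $\mathrm C_U(K)$, where $K$ is a representative of $\alpha$ that is a closed normal subgroup of a compact open subgroup $U$ of $G$ (this class does not depend on the choices). The centraliser lattice $\mathcal{LC}(G)=\{\alpha^\perp \mid \alpha\in\mathcal{LN}(G)\}$, with the order of $\mathcal{LN}(G)$, is a Boolean lattice on which $G$ acts by conjugation; let $\Omega=\Omega(G)$ be its Stone space (the space of its ultrafilters), with the induced $G$-action. A closed subgroup $H\le G$ is cocompact if $G/H$ is compact, and a locally compact group is amenable if the space of bounded continuous real functions on it carries a left-invariant mean. Then: (i) every closed cocompact amenable subgroup of $G$ fixes a point of $\Omega$; (ii) if $\mathcal{LC}(G)\neq\{0,\infty\}$, then $G$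 is not amenable; (iii) if $G$ contains a closed cocompact amenable subgroup, then the $G$-action on $\Omega$ is transitive. -/

import Mathlib

open scoped Pointwise BoundedContinuousFunction

namespace TDLC

universe u

/-- The class `𝒮` of compactly generated locally compact groups that are totally disconnected,
topologically simple and non-discrete. (The Hausdorff property follows from total
disconnectedness.) -/
class ClassS (G : Type u) [Group G] [TopologicalSpace G] : Prop extends
    IsTopologicalGroup G, LocallyCompactSpace G, TotallyDisconnectedSpace G where
  /-- `G` is generated by a compact subset. -/
  compactlyGenerated : ∃ K : Set G, IsCompact K ∧ Subgroup.closure K = ⊤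
  /-- `G` is topologically simple. -/
  nontrivial : Nontrivial G
  eq_bot_or_eq_top : ∀ N : Subgroup G, N.Normal → IsClosed (N : Set G) → N = ⊥ ∨ N = ⊤
  /-- `G` is non-discrete. -/
  nondiscrete : ¬ DiscreteTopology G

/-- A topological group `H` (locally compact in all the uses below) is amenable if there is a
left-invariant mean on the space of bounded continuous real functions on `H`: a positive
normalised linear functional `m` with `m (x ↦ f (h x)) = m f`. -/
def IsAmenable (H : Type u) [Group H] [TopologicalSpace H] [IsTopologicalGroup H] : Prop :=
  ∃ m : (H →ᵇ ℝ) →ₗ[ℝ] ℝ,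
    (∀ f : H →ᵇ ℝ, (∀ x, 0 ≤ f x) → 0 ≤ m f) ∧
    m (BoundedContinuousFunction.const H 1) = 1 ∧
    ∀ (h : H) (f : H →ᵇ ℝ), m (f.compContinuous (ContinuousMap.mulLeft h)) = m f

/-- A closed cocompact amenable subgroup. -/
structure IsClosedCocompactAmenable {G : Type u} [Group G] [TopologicalSpace G]
    [IsTopologicalGroup G] (H : Subgroup G) : Prop where
  isClosed : IsClosed (H : Set G)
  cocompact : CompactSpace (G ⧸ H)
  amenable : IsAmenable H

/-- A locally normal subgroup: a compact subgroup whose normaliser is open. -/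
structure LocallyNormal (G : Type u) [Group G] [TopologicalSpace G] where
  toSubgroup : Subgroup G
  isCompact : IsCompact (toSubgroup : Set G)
  isOpen_normalizer : IsOpen (Subgroup.normalizer (toSubgroup : Set G) : Set G)

section ConjLemmas

variable {G : Type u} [Group G]

theorem coe_conj_smul (g : G) (K : Subgroup G) :
    ((MulAut.conj g • K : Subgroup G) : Set G) = (fun x => g * x * g⁻¹) '' (K : Set G) := by
  ext x
  simp [Set.mem_smul_set]

theorem normalizer_conj_smul (g : G) (K : Subgroup G) :
    Subgroup.normalizer ((MulAut.conj g • K : Subgroup G) : Set G) =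
      MulAut.conj g • Subgroup.normalizer (K : Set G) :=
  (Subgroup.map_equiv_normalizer_eq K (MulAut.conj g)).symm

theorem centralizer_conj_smul (g : G) (K : Subgroup G) :
    Subgroup.centralizer ((MulAut.conj g • K : Subgroup G) : Set G) =
      MulAut.conj g • Subgroup.centralizer (K : Set G) := by
  ext x
  simp only [Subgroup.mem_pointwise_smul_iff_inv_smul_mem, Subgroup.mem_centralizer_iff,
    coe_conj_smul, Set.forall_mem_image]
  refine forall₂_congr fun k _ => ?_
  have : (MulAut.conj g)⁻¹ • x = g⁻¹ * x * g := by
    rw [← map_inv, MulAut.smul_def, MulAut.conj_apply, inv_inv]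
  rw [this]
  constructor <;> intro h
  · calc k * (g⁻¹ * x * g) = g⁻¹ * ((g * k * g⁻¹) * x) * g := by group
      _ = g⁻¹ * (x * (g * k * g⁻¹)) * g := by rw [h]
      _ = _ := by group
  · calc (g * k * g⁻¹) * x = g * (k * (g⁻¹ * x * g)) * g⁻¹ := by group
      _ = g * ((g⁻¹ * x * g) * k) * g⁻¹ := by rw [h]
      _ = _ := by group

theorem normalizer_inf_le (K L : Subgroup G) :
    Subgroup.normalizer (K : Set G) ⊓ Subgroup.normalizer (L : Set G) ≤
      Subgroup.normalizer ((K ⊓ L : Subgroup G) : Set G) := by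
  intro x hx
  rw [Subgroup.mem_inf, Subgroup.mem_normalizer_iff, Subgroup.mem_normalizer_iff] at hx
  rw [Subgroup.mem_normalizer_iff]
  intro y
  rw [Subgroup.mem_inf, Subgroup.mem_inf, hx.1 y, hx.2 y]

variable [TopologicalSpace G] [IsTopologicalGroup G]

theorem isCompact_conj_smul (g : G) {K : Subgroup G} (hK : IsCompact (K : Set G)) :
    IsCompact ((MulAut.conj g • K : Subgroup G) : Set G) := by
  rw [coe_conj_smul]
  exact hK.image (by fun_prop)

theorem isOpen_conj_smul (g : G) {K : Subgroup G} (hK : IsOpen (K : Set G)) :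
    IsOpen ((MulAut.conj g • K : Subgroup G) : Set G) := by
  rw [coe_conj_smul]
  exact ((Homeomorph.mulLeft g).trans (Homeomorph.mulRight g⁻¹)).isOpenMap _ hK

end ConjLemmas

/-- Van Dantzig: a totally disconnected locally compact group has a compact open subgroup. -/
theorem exists_compact_open_subgroup (G : Type u) [Group G] [TopologicalSpace G]
    [IsTopologicalGroup G] [LocallyCompactSpace G] [TotallyDisconnectedSpace G] :
    ∃ U : Subgroup G, IsCompact (U : Set G) ∧ IsOpen (U : Set G) := by
  obtain ⟨C, hC, hC1⟩ := exists_compact_mem_nhds (1 : G)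
  obtain ⟨W, hW, h1W, hWC⟩ := (loc_compact_Haus_tot_disc_of_zero_dim (H := G)).exists_subset_of_mem_open
    (mem_interior_iff_mem_nhds.2 hC1) isOpen_interior
  have hWc : IsCompact W := hC.of_isClosed_subset hW.isClosed (hWC.trans interior_subset)
  obtain ⟨V, hV, hVW⟩ := compact_open_separated_mul_right hWc hW.isOpen le_rfl
  let S : Subgroup G :=
    { carrier := {x | ∀ w ∈ W, w * x ∈ W ∧ w * x⁻¹ ∈ W}
      one_mem' := by simp
      mul_mem' := by
        intro x y hx hy w hw
        refine ⟨?_, ?_⟩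
        · rw [← mul_assoc w x y]
          exact (hy _ (hx w hw).1).1
        · rw [mul_inv_rev, ← mul_assoc]
          exact (hx _ (hy w hw).2).2
      inv_mem' := by
        intro x hx w hw
        exact ⟨(hx w hw).2, by simpa using (hx w hw).1⟩ }
  have hS : V ∩ V⁻¹ ⊆ (S : Set G) := fun x hx w hw =>
    ⟨hVW (Set.mul_mem_mul hw hx.1), hVW (Set.mul_mem_mul hw hx.2)⟩
  have ho : IsOpen (S : Set G) :=
    Subgroup.isOpen_of_mem_nhds _ (g := 1) (Filter.mem_of_superset
      (Filter.inter_mem hV (inv_mem_nhds_one G hV)) hS)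
  exact ⟨S, hWc.of_isClosed_subset (Subgroup.isClosed_of_isOpen _ ho)
    (fun x hx => by simpa using (hx 1 h1W).1), ho⟩

/-- An open subgroup has finite index relative to a compact subgroup. -/
theorem relIndex_ne_zero_of_open {G : Type u} [Group G] [TopologicalSpace G]
    [IsTopologicalGroup G] {U K : Subgroup G} (hU : IsOpen (U : Set G))
    (hK : IsCompact (K : Set G)) : U.relIndex K ≠ 0 := by
  have : CompactSpace K := isCompact_iff_compactSpace.1 hK
  have ho : IsOpen (U.subgroupOf K : Set K) := hU.preimage continuous_subtype_val
  have := Subgroup.quotient_finite_of_isOpen _ ho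
  exact Subgroup.index_ne_zero_of_finite (H := U.subgroupOf K)

namespace LocallyNormal

variable {G : Type u} [Group G] [TopologicalSpace G]

@[ext]
theorem ext {K L : LocallyNormal G} (h : K.toSubgroup = L.toSubgroup) : K = L := by
  cases K; cases L; cases h; rfl

/-- Commensurability of locally normal subgroups. -/
instance setoid (G : Type u) [Group G] [TopologicalSpace G] : Setoid (LocallyNormal G) where
  r K L := Subgroup.Commensurable K.toSubgroup L.toSubgroup
  iseqv := ⟨fun _ => Subgroup.Commensurable.refl _, Subgroup.Commensurable.symm,
    Subgroup.Commensurable.trans⟩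

variable [IsTopologicalGroup G]

/-- A compact open subgroup, as a locally normal subgroup. -/
def ofOpen (U : Subgroup G) (hc : IsCompact (U : Set G)) (ho : IsOpen (U : Set G)) :
    LocallyNormal G :=
  ⟨U, hc, Subgroup.isOpen_mono Subgroup.le_normalizer ho⟩

/-- The trivial subgroup, as a locally normal subgroup. -/
def trivial (G : Type u) [Group G] [TopologicalSpace G] : LocallyNormal G where
  toSubgroup := ⊥
  isCompact := by simp
  isOpen_normalizer := by
    rw [Subgroup.normalizer_eq_top]
    simp

/-- The conjugate `g K g⁻¹` of a locally normal subgroup `K`. -/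
def conj (g : G) (K : LocallyNormal G) : LocallyNormal G where
  toSubgroup := MulAut.conj g • K.toSubgroup
  isCompact := isCompact_conj_smul g K.isCompact
  isOpen_normalizer := by
    rw [normalizer_conj_smul]
    exact isOpen_conj_smul g K.isOpen_normalizer

variable [T2Space G]

/-- The intersection of two locally normal subgroups. -/
def inf (K L : LocallyNormal G) : LocallyNormal G where
  toSubgroup := K.toSubgroup ⊓ L.toSubgroup
  isCompact := K.isCompact.inter_right L.isCompact.isClosed
  isOpen_normalizer := Subgroup.isOpen_mono (normalizer_inf_le _ _)
    (K.isOpen_normalizer.inter L.isOpen_normalizer)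

/-- The centraliser `C_U(K)` of a subgroup `K` in a compact open subgroup `U` normalising `K`. -/
def centralizerIn (U K : Subgroup G) (hc : IsCompact (U : Set G)) (ho : IsOpen (U : Set G))
    (hn : U ≤ Subgroup.normalizer (K : Set G)) : LocallyNormal G where
  toSubgroup := U ⊓ Subgroup.centralizer (K : Set G)
  isCompact := by
    refine hc.inter_right ?_
    exact Set.isClosed_centralizer _
  isOpen_normalizer := by
    refine Subgroup.isOpen_mono ?_ ho
    intro u hu
    rw [Subgroup.mem_normalizer_iff]
    have key : ∀ v ∈ U, ∀ y ∈ U ⊓ Subgroup.centralizer (K : Set G),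
        v * y * v⁻¹ ∈ U ⊓ Subgroup.centralizer (K : Set G) := by
      intro v hv y hy
      refine ⟨U.mul_mem (U.mul_mem hv hy.1) (U.inv_mem hv), ?_⟩
      have hy2 := Subgroup.mem_centralizer_iff.1 hy.2
      refine Subgroup.mem_centralizer_iff.2 fun k hk => ?_
      have hk' : v⁻¹ * k * v ∈ K := by
        have := (Subgroup.mem_normalizer_iff.1 (hn (U.inv_mem hv)) k).1 hk
        simpa using this
      have := hy2 _ hk'
      calc k * (v * y * v⁻¹) = v * ((v⁻¹ * k * v) * y) * v⁻¹ := by group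
        _ = v * (y * (v⁻¹ * k * v)) * v⁻¹ := by rw [this]
        _ = _ := by group
    intro y
    refine ⟨key u hu y, fun h => ?_⟩
    have := key u⁻¹ (U.inv_mem hu) _ h
    simpa [mul_assoc] using this

end LocallyNormal

/-- The structure lattice `LN(G)`: locally normal subgroups modulo commensurability. -/
def LN (G : Type u) [Group G] [TopologicalSpace G] : Type u :=
  Quotient (LocallyNormal.setoid G)

namespace LN

variable {G : Type u} [Group G] [TopologicalSpace G]

/-- The commensurability class of a locally normal subgroup. -/
def mk (K : LocallyNormal G) : LN G := Quotient.mk _ K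

theorem mk_eq_mk {K L : LocallyNormal G} :
    mk K = mk L ↔ Subgroup.Commensurable K.toSubgroup L.toSubgroup :=
  Quotient.eq (r := LocallyNormal.setoid G)

theorem ind {p : LN G → Prop} (h : ∀ K, p (mk K)) (α : LN G) : p α := Quotient.ind h α

/-- The order on `LN(G)` induced by inclusion of locally normal subgroups. -/
instance : LE (LN G) where
  le α β := ∃ K L : LocallyNormal G, mk K = α ∧ mk L = β ∧ K.toSubgroup ≤ L.toSubgroup

variable [IsTopologicalGroup G]

/-- The conjugation action of `G` on `LN(G)`. -/
instance : MulAction G (LN G) where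
  smul g := Quotient.map (LocallyNormal.conj g) (by
    intro K L h
    exact ⟨by simpa [LocallyNormal.conj, Subgroup.relIndex_pointwise_smul] using h.1,
      by simpa [LocallyNormal.conj, Subgroup.relIndex_pointwise_smul] using h.2⟩)
  one_smul := ind fun K => congrArg mk <| LocallyNormal.ext <| by
    simp [LocallyNormal.conj]
  mul_smul g h := ind fun K => congrArg mk <| LocallyNormal.ext <| by
    simp [LocallyNormal.conj, mul_smul]

theorem smul_mk (g : G) (K : LocallyNormal G) : g • mk K = mk (K.conj g) := rfl

theorem smul_le_smul (g : G) {α β : LN G} (h : α ≤ β) : g • α ≤ g • β := by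
  obtain ⟨K, L, rfl, rfl, h⟩ := h
  exact ⟨K.conj g, L.conj g, rfl, rfl, Subgroup.pointwise_smul_le_pointwise_smul_iff.2 h⟩

variable [T2Space G]

theorem mk_le_mk {K L : LocallyNormal G} :
    mk K ≤ mk L ↔ L.toSubgroup.relIndex K.toSubgroup ≠ 0 := by
  constructor
  · rintro ⟨K', L', hK, hL, h⟩
    have h1 : L'.toSubgroup.relIndex K'.toSubgroup ≠ 0 := by
      rw [Subgroup.relIndex_eq_one.2 h]; exact one_ne_zero
    exact Subgroup.relIndex_ne_zero_trans (mk_eq_mk.1 hL).2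
      (Subgroup.relIndex_ne_zero_trans h1 (mk_eq_mk.1 hK).1)
  · intro h
    refine ⟨K.inf L, L, mk_eq_mk.2 ⟨?_, ?_⟩, rfl, inf_le_right⟩
    · simpa [LocallyNormal.inf, Subgroup.inf_relIndex_left] using h
    · rw [Subgroup.relIndex_eq_one.2 (show (K.inf L).toSubgroup ≤ K.toSubgroup from inf_le_left)]
      exact one_ne_zero

instance : PartialOrder (LN G) where
  le_refl := ind fun K => ⟨K, K, rfl, rfl, le_rfl⟩
  le_trans := ind fun K => ind fun L => ind fun M h₁ h₂ =>
    mk_le_mk.2 (Subgroup.relIndex_ne_zero_trans (mk_le_mk.1 h₂) (mk_le_mk.1 h₁))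
  le_antisymm := ind fun K => ind fun L h₁ h₂ =>
    mk_eq_mk.2 ⟨mk_le_mk.1 h₂, mk_le_mk.1 h₁⟩

/-- The minimum `0` of `LN(G)` is the class of the trivial subgroup. -/
instance : OrderBot (LN G) where
  bot := mk (LocallyNormal.trivial G)
  bot_le := ind fun K => ⟨_, K, rfl, rfl, bot_le⟩

/-- The maximum `∞` of `LN(G)` is the class of the compact open subgroups. -/
noncomputable instance [LocallyCompactSpace G] [TotallyDisconnectedSpace G] :
    OrderTop (LN G) where
  top := mk (LocallyNormal.ofOpen (exists_compact_open_subgroup G).choose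
    (exists_compact_open_subgroup G).choose_spec.1 (exists_compact_open_subgroup G).choose_spec.2)
  le_top := ind fun K => mk_le_mk.2
    (relIndex_ne_zero_of_open (exists_compact_open_subgroup G).choose_spec.2 K.isCompact)

theorem mk_ofOpen [LocallyCompactSpace G] [TotallyDisconnectedSpace G] (U : Subgroup G)
    (hc : IsCompact (U : Set G)) (ho : IsOpen (U : Set G)) :
    mk (LocallyNormal.ofOpen U hc ho) = ⊤ :=
  top_le_iff.1 (mk_le_mk.2 (relIndex_ne_zero_of_open ho (LocallyNormal.isCompact _)))

/-- `IsPerp α β` says that `β = α^⊥`, i.e. that `β` is the class of `C_U(K)` for some compact open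
subgroup `U` of `G` and some representative `K` of `α` that is a (closed) normal subgroup
of `U`. -/
def IsPerp (α β : LN G) : Prop :=
  ∃ (K : LocallyNormal G) (U : Subgroup G) (hc : IsCompact (U : Set G)) (ho : IsOpen (U : Set G))
    (_ : K.toSubgroup ≤ U) (hn : U ≤ Subgroup.normalizer (K.toSubgroup : Set G)),
    mk K = α ∧ mk (LocallyNormal.centralizerIn U K.toSubgroup hc ho hn) = β

theorem IsPerp.smul (g : G) {α β : LN G} (h : IsPerp α β) : IsPerp (g • α) (g • β) := by
  obtain ⟨K, U, hc, ho, hK, hn, rfl, rfl⟩ := h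
  refine ⟨K.conj g, MulAut.conj g • U, isCompact_conj_smul g hc, isOpen_conj_smul g ho,
    Subgroup.pointwise_smul_le_pointwise_smul_iff.2 hK, ?_, rfl, ?_⟩
  · rw [LocallyNormal.conj, normalizer_conj_smul]
    exact Subgroup.pointwise_smul_le_pointwise_smul_iff.2 hn
  · rw [smul_mk]
    refine congrArg mk (LocallyNormal.ext ?_)
    simp only [LocallyNormal.centralizerIn, LocallyNormal.conj, centralizer_conj_smul,
      Subgroup.smul_inf]

end LN

/-- The centraliser lattice `LC(G) = {α^⊥ | α ∈ LN(G)}`, with the order of `LN(G)`. -/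
def LC (G : Type u) [Group G] [TopologicalSpace G] [IsTopologicalGroup G] [T2Space G] :
    Set (LN G) :=
  {β | ∃ α, LN.IsPerp α β}

variable {G : Type u} [Group G] [TopologicalSpace G] [IsTopologicalGroup G] [T2Space G]

/-- The conjugation action of `G` on `LC(G)`. -/
instance : MulAction G (LC G) where
  smul g β := ⟨g • β.1, let ⟨α, h⟩ := β.2; ⟨g • α, h.smul g⟩⟩
  one_smul β := Subtype.ext (one_smul G β.1)
  mul_smul g h β := Subtype.ext (mul_smul g h β.1)

theorem LC.smul_le_smul (g : G) {α β : LC G} (h : α ≤ β) : g • α ≤ g • β :=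
  LN.smul_le_smul g (α := α.1) (β := β.1) h

/-- The Stone space of the Boolean lattice `LC(G)`: the set of its ultrafilters, i.e. of the
maximal proper filters. -/
@[ext]
structure StoneSpace (G : Type u) [Group G] [TopologicalSpace G] [IsTopologicalGroup G]
    [T2Space G] where
  toPFilter : Order.PFilter (LC G)
  proper : (toPFilter : Set (LC G)) ≠ Set.univ
  maximal : ∀ F : Order.PFilter (LC G), toPFilter ≤ F → (F : Set (LC G)) ≠ Set.univ →
    F = toPFilter

/-- The Stone topology: the sets of all ultrafilters containing a given element form a basis. -/
instance : TopologicalSpace (StoneSpace G) :=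
  TopologicalSpace.generateFrom {s | ∃ α : LC G, s = {ω : StoneSpace G | α ∈ ω.toPFilter}}

/-- The translate `gF = {gα | α ∈ F} = {α | g⁻¹α ∈ F}` of a filter `F` of `LC(G)`. -/
def smulPFilter (g : G) (F : Order.PFilter (LC G)) : Order.PFilter (LC G) :=
  Order.IsPFilter.toPFilter (F := {α | g⁻¹ • α ∈ F}) <| Order.IsPFilter.of_def
    (by
      obtain ⟨α, hα⟩ := F.nonempty
      exact ⟨g • α, by simpa using hα⟩)
    (by
      intro α hα β hβ
      obtain ⟨γ, hγ, h₁, h₂⟩ := F.directed _ hα _ hβ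
      refine ⟨g • γ, by simpa using hγ, ?_, ?_⟩
      · exact (LC.smul_le_smul g h₁).trans_eq (smul_inv_smul g _)
      · exact (LC.smul_le_smul g h₂).trans_eq (smul_inv_smul g _))
    (fun h hα => Order.PFilter.mem_of_le (LC.smul_le_smul g⁻¹ h) hα)

theorem mem_smulPFilter {g : G} {F : Order.PFilter (LC G)} {α : LC G} :
    α ∈ smulPFilter g F ↔ g⁻¹ • α ∈ F := Iff.rfl

/-- The action of `G` on the Stone space of `LC(G)` induced by its action on `LC(G)`. -/
instance : MulAction G (StoneSpace G) where
  smul g ω :=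
    { toPFilter := smulPFilter g ω.toPFilter
      proper := by
        intro h
        refine ω.proper (Set.eq_univ_of_forall fun α => ?_)
        have : g • α ∈ smulPFilter g ω.toPFilter := by
          rw [← SetLike.mem_coe, h]; trivial
        simpa [mem_smulPFilter] using this
      maximal := by
        intro F hF hF'
        have := ω.maximal (smulPFilter g⁻¹ F)
          (fun α hα => mem_smulPFilter.2 (hF (mem_smulPFilter.2 (by simpa using hα))))
          (fun h => hF' (Set.eq_univ_of_forall fun α => by
            have : g⁻¹ • α ∈ smulPFilter g⁻¹ F := by
              rw [← SetLike.mem_coe, h]; trivial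
            simpa [mem_smulPFilter] using this))
        rw [← this]
        refine SetLike.ext fun α => ?_
        simp [mem_smulPFilter] }
  one_smul ω := StoneSpace.ext <| SetLike.ext fun α => by
    change (1 : G)⁻¹ • α ∈ ω.toPFilter ↔ _
    simp
  mul_smul g h ω := StoneSpace.ext <| SetLike.ext fun α => by
    change (g * h)⁻¹ • α ∈ ω.toPFilter ↔ h⁻¹ • g⁻¹ • α ∈ ω.toPFilter
    rw [mul_inv_rev, mul_smul]

end TDLC

/-! The engine is a rigidity fact, `LN.mk_eq_bot_of_forall_smul_eq`: a locally normal subgroup `L`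
with `G`-invariant class and nontrivial centraliser has class `0`. The elements centralising an open
subgroup of `L` form a nontrivial, hence dense, normal subgroup; compact generation then makes a
small piece of `L` normal in `G`, hence trivial. It follows that the quasi-centre is trivial, that
abelian locally normal subgroups are trivial, that locally normal subgroups meeting trivially
commute up to an open subgroup, and that finitely many conjugates of a nontrivial one together meet
every other. Hence `α^⊥` is the pseudocomplement of `α`, `LC(G)` is Boolean, and `G` acts minimally
on `Ω`.

Two dynamical facts carry the rest. By `LC.exists_compressible` some `α ≠ 0` has a translate below
every nonzero element; by `LC.exists_smul_mem_and_mem` any two points of `Ω` lie in a common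
translate of `α`.

Let `H` be cocompact and amenable. Averaging along an orbit gives an `H`-invariant finitely additive
probability measure `μ` on `LC(G)`. By cocompactness `μ (g • α)` attains a maximum `M`, and
compressibility with compactness of `G ⧸ H` gives a point `ξ` all of whose neighbourhoods have mass
at least `M`. Suppose `β` misses `ξ` and is not null. Choose `y` in `β` with no null neighbourhood,
and a translate of `α` containing `ξ` and `y`. Its mass is at most `M`, its part outside `β` already
has mass at least `M`, so its part inside `β` is a null neighbourhood of `y`, a contradiction. So
`μ` is the point mass at `ξ`, and `H` fixes `ξ`.

Given such a fixed point, minimality and compactness of `G ⧸ H` make every point of `Ω` a translate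
of it. If `G` itself were amenable it would fix a point, which by minimality would contain every
nonzero element, hence some `β` and its complement unless `LC(G)` is trivial. -/

namespace TDLC

universe u

/-! ### Normalisers, centralisers and conjugates -/

section Groups

variable {G : Type u} [Group G]

theorem conj_mem_of_le_normalizer {U K : Subgroup G} (h : U ≤ Subgroup.normalizer (K : Set G))
    {u k : G} (hu : u ∈ U) (hk : k ∈ K) : u * k * u⁻¹ ∈ K :=
  Subgroup.le_normalizer_iff.1 h u hu k hk

/-- Elements of two subgroups with trivial intersection that normalise each other commute. -/
theorem mul_comm_of_inf_eq_bot {K L : Subgroup G} (h : K ⊓ L = ⊥) {x y : G} (hx : x ∈ K)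
    (hy : y ∈ L) (hxL : x ∈ Subgroup.normalizer (L : Set G))
    (hyK : y ∈ Subgroup.normalizer (K : Set G)) : x * y = y * x := by
  have h1 : x * y * x⁻¹ * y⁻¹ ∈ K ⊓ L := by
    refine ⟨?_, L.mul_mem ((Subgroup.mem_normalizer_iff.1 hxL y).1 hy) (L.inv_mem hy)⟩
    have := K.mul_mem hx ((Subgroup.mem_normalizer_iff.1 hyK x⁻¹).1 (K.inv_mem hx))
    simpa [mul_assoc] using this
  rw [h, Subgroup.mem_bot] at h1
  exact mul_inv_eq_iff_eq_mul.1 (mul_inv_eq_one.1 h1)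

theorem mem_conj_smul {g x : G} {K : Subgroup G} : x ∈ MulAut.conj g • K ↔ g⁻¹ * x * g ∈ K := by
  rw [Subgroup.mem_pointwise_smul_iff_inv_smul_mem, ← map_inv, MulAut.smul_def, MulAut.conj_apply,
    inv_inv]

theorem le_normalizer_centralizer {U K : Subgroup G} (h : U ≤ Subgroup.normalizer (K : Set G)) :
    U ≤ Subgroup.normalizer (Subgroup.centralizer (K : Set G) : Set G) := by
  refine Subgroup.le_normalizer_iff.2 fun u hu x hx => Subgroup.mem_centralizer_iff.2 fun k hk => ?_
  have hk' : u⁻¹ * k * u ∈ K := by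
    simpa using conj_mem_of_le_normalizer h (U.inv_mem hu) hk
  have := Subgroup.mem_centralizer_iff.1 hx _ hk'
  calc k * (u * x * u⁻¹) = u * ((u⁻¹ * k * u) * x) * u⁻¹ := by group
    _ = u * (x * (u⁻¹ * k * u)) * u⁻¹ := by rw [this]
    _ = _ := by group

theorem le_normalizer_inf {U K L : Subgroup G} (hK : U ≤ Subgroup.normalizer (K : Set G))
    (hL : U ≤ Subgroup.normalizer (L : Set G)) :
    U ≤ Subgroup.normalizer ((K ⊓ L : Subgroup G) : Set G) :=
  (le_inf hK hL).trans (normalizer_inf_le K L)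

end Groups

/-! ### Small compact open subgroups and the order on `LN(G)` -/

section Topology

variable {G : Type u} [Group G] [TopologicalSpace G] [IsTopologicalGroup G]

/-- The join of a compact subgroup and a compact subgroup normalising it is compact. -/
theorem isCompact_sup {K V : Subgroup G} (hK : IsCompact (K : Set G)) (hV : IsCompact (V : Set G))
    (h : V ≤ Subgroup.normalizer (K : Set G)) : IsCompact ((K ⊔ V : Subgroup G) : Set G) := by
  rw [Subgroup.coe_mul_of_right_le_normalizer_left K V h]
  exact hK.mul hV

variable [TotallyDisconnectedSpace G]

/-- A compact open subgroup has arbitrarily small open subgroups that it normalises. -/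
theorem exists_open_subgroup_le_normalizer {U : Subgroup G} (hc : IsCompact (U : Set G))
    (ho : IsOpen (U : Set G)) {O : Set G} (hO : O ∈ nhds (1 : G)) :
    ∃ V : Subgroup G, V ≤ U ∧ IsCompact (V : Set G) ∧ IsOpen (V : Set G) ∧ (V : Set G) ⊆ O ∧
      U ≤ Subgroup.normalizer (V : Set G) := by
  obtain ⟨O', hO', hO'o, h1⟩ := mem_nhds_iff.1 hO
  have : CompactSpace U := isCompact_iff_compactSpace.1 hc
  obtain ⟨H, hH⟩ := ProfiniteGrp.exist_openNormalSubgroup_sub_open_nhds_of_one (G := U)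
    (hO'o.preimage continuous_subtype_val) (by simpa using h1)
  have hHo : IsOpen (H.toSubgroup : Set U) := H.isOpen'
  have hHc : IsClosed (H.toSubgroup : Set U) := Subgroup.isClosed_of_isOpen _ hHo
  have hle : H.toSubgroup.map U.subtype ≤ U := Subgroup.map_subtype_le _
  refine ⟨H.toSubgroup.map U.subtype, hle, ?_, ?_, ?_, ?_⟩
  · rw [Subgroup.coe_map]
    exact hHc.isCompact.image continuous_subtype_val
  · rw [Subgroup.coe_map]
    exact ho.isOpenMap_subtype_val _ hHo
  · rintro _ ⟨x, hx, rfl⟩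
    exact hO' (hH hx)
  · rw [← Subgroup.normal_subgroupOf_iff_le_normalizer hle]
    have : (H.toSubgroup.map U.subtype).subgroupOf U = H.toSubgroup :=
      Subgroup.comap_map_eq_self_of_injective U.subtype_injective _
    rw [this]
    exact H.isNormal'

variable [LocallyCompactSpace G]

theorem exists_compact_open_subgroup_subset {O : Set G} (hO : O ∈ nhds (1 : G)) :
    ∃ V : Subgroup G, IsCompact (V : Set G) ∧ IsOpen (V : Set G) ∧ (V : Set G) ⊆ O := by
  obtain ⟨U, hc, ho⟩ := exists_compact_open_subgroup G
  obtain ⟨V, -, hVc, hVo, hV, -⟩ := exists_open_subgroup_le_normalizer hc ho hO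
  exact ⟨V, hVc, hVo, hV⟩

theorem exists_compact_open_subgroup_le {O : Subgroup G} (hO : IsOpen (O : Set G)) :
    ∃ V : Subgroup G, IsCompact (V : Set G) ∧ IsOpen (V : Set G) ∧ V ≤ O :=
  exists_compact_open_subgroup_subset (hO.mem_nhds O.one_mem)

/-- The order of `LN(G)` in terms of inclusions of open subgroups. -/
theorem LN.mk_le_mk_iff_exists_open [T2Space G] {K L : LocallyNormal G} :
    LN.mk K ≤ LN.mk L ↔
      ∃ V : Subgroup G, IsOpen (V : Set G) ∧ K.toSubgroup ⊓ V ≤ L.toSubgroup := by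
  rw [LN.mk_le_mk]
  constructor
  · intro h
    have : CompactSpace K.toSubgroup := isCompact_iff_compactSpace.1 K.isCompact
    have : (L.toSubgroup.subgroupOf K.toSubgroup).FiniteIndex := ⟨h⟩
    have ho : IsOpen (L.toSubgroup.subgroupOf K.toSubgroup : Set K.toSubgroup) :=
      Subgroup.isOpen_of_isClosed_of_finiteIndex _
        (L.isCompact.isClosed.preimage continuous_subtype_val)
    obtain ⟨O, hO, hOL⟩ := isOpen_induced_iff.1 ho
    have h1 : (1 : G) ∈ O := by
      have : (1 : K.toSubgroup) ∈ Subtype.val ⁻¹' O := by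
        rw [hOL]; exact Subgroup.one_mem _
      exact this
    obtain ⟨V, -, hV, hVO⟩ := exists_compact_open_subgroup_subset (hO.mem_nhds h1)
    refine ⟨V, hV, fun x hx => ?_⟩
    have : (⟨x, hx.1⟩ : K.toSubgroup) ∈ Subtype.val ⁻¹' O := hVO hx.2
    rw [hOL] at this
    exact this
  · rintro ⟨V, hV, hVL⟩ h
    have := Subgroup.relIndex_eq_zero_of_le_left hVL h
    rw [Subgroup.inf_relIndex_left] at this
    exact relIndex_ne_zero_of_open hV K.isCompact this

end Topology

/-! ### Rigidity of invariant classes and triviality of the quasi-centre -/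

section DenseGeneration

variable {G : Type u} [Group G] [TopologicalSpace G] [ClassS G]

/-- A compactly generated group is generated by an open subgroup and finitely many elements of a
given dense subgroup. -/
theorem exists_finset_closure_eq_top {N U : Subgroup G} (hN : N.topologicalClosure = ⊤)
    (hU : IsOpen (U : Set G)) :
    ∃ F : Finset G, (∀ x ∈ F, x ∈ N) ∧ Subgroup.closure ((U : Set G) ∪ F) = ⊤ := by
  obtain ⟨K, hK, hKG⟩ := ClassS.compactlyGenerated (G := G)
  have hd : Dense (N : Set G) := by
    intro x
    rw [← Subgroup.topologicalClosure_coe, hN]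
    trivial
  -- As `N` is dense, the cosets `U n` with `n ∈ N` cover the compact generating set.
  obtain ⟨t, ht⟩ := hK.elim_finite_subcover (fun n : N => {x : G | x * (n : G)⁻¹ ∈ U})
    (fun n => hU.preimage (continuous_mul_const _)) (fun x _ => by
      obtain ⟨n, hn, hnN⟩ := hd.exists_mem_open
        (hU.preimage (continuous_const.mul continuous_inv : Continuous fun y : G => x * y⁻¹))
        ⟨x, by simp⟩
      exact Set.mem_iUnion.2 ⟨⟨n, hn⟩, hnN⟩)
  classical
  refine ⟨t.image Subtype.val, by simp +contextual, ?_⟩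
  rw [eq_top_iff, ← hKG, Subgroup.closure_le]
  intro x hx
  obtain ⟨n, hn, hxn⟩ := Set.mem_iUnion₂.1 (ht hx)
  have h2 : (n : G) ∈ Subgroup.closure ((U : Set G) ∪ (t.image Subtype.val : Finset G)) :=
    Subgroup.subset_closure (Or.inr (by simpa using hn))
  have h1 : x * (n : G)⁻¹ ∈ Subgroup.closure ((U : Set G) ∪ (t.image Subtype.val : Finset G)) :=
    Subgroup.subset_closure (Or.inl hxn)
  simpa using Subgroup.mul_mem _ h1 h2

theorem topologicalClosure_eq_top_of_normal {N : Subgroup G} [N.Normal] (hN : N ≠ ⊥) :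
    N.topologicalClosure = ⊤ := by
  refine (ClassS.eq_bot_or_eq_top _ N.is_normal_topologicalClosure
    N.isClosed_topologicalClosure).resolve_left fun h => hN ?_
  exact le_bot_iff.1 (h ▸ N.le_topologicalClosure)

/-- A proper closed normal subgroup is trivial. -/
theorem eq_bot_of_normal_of_isClosed {N : Subgroup G} (hN : N.Normal) (hc : IsClosed (N : Set G))
    {x : G} (hx : x ∉ N) : N = ⊥ :=
  (ClassS.eq_bot_or_eq_top N hN hc).resolve_right fun h => hx (h ▸ Subgroup.mem_top x)

theorem ne_bot_of_isOpen {V : Subgroup G} (hV : IsOpen (V : Set G)) : V ≠ ⊥ := by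
  rintro rfl
  refine ClassS.nondiscrete (G := G) (discreteTopology_of_isOpen_singleton_one ?_)
  simpa using hV

/-- A locally normal subgroup whose class is fixed by `G` and whose centraliser is nontrivial is
finite. -/
theorem LN.mk_eq_bot_of_forall_smul_eq {L : LocallyNormal G}
    (hfix : ∀ g : G, g • LN.mk L = LN.mk L) {x : G} (hx : x ∈ Subgroup.centralizer (L.toSubgroup : Set G)) (hx1 : x ≠ 1) :
    LN.mk L = ⊥ := by
  -- The elements that centralise some open subgroup of `L`. This is normal because the class of `L`
  -- is invariant, and it contains `x`, so it is dense.
  let N : Subgroup G :=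
    { carrier := {g | ∃ V : Subgroup G, IsOpen (V : Set G) ∧
        ∀ l ∈ L.toSubgroup, l ∈ V → g * l = l * g}
      one_mem' := ⟨⊤, isOpen_univ, by simp⟩
      mul_mem' := by
        rintro a b ⟨V, hV, ha⟩ ⟨W, hW, hb⟩
        refine ⟨V ⊓ W, hV.inter hW, fun l hl hlV => ?_⟩
        rw [mul_assoc, hb l hl hlV.2, ← mul_assoc, ha l hl hlV.1, mul_assoc]
      inv_mem' := by
        rintro a ⟨V, hV, ha⟩
        refine ⟨V, hV, fun l hl hlV => ?_⟩
        rw [inv_mul_eq_iff_eq_mul, ← mul_assoc, ha l hl hlV, mul_inv_cancel_right] }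
  have hNn : N.Normal := by
    refine ⟨?_⟩
    rintro n ⟨V, hV, hn⟩ g
    obtain ⟨V', hV', hVg⟩ := LN.mk_le_mk_iff_exists_open.1 (hfix g).ge
    refine ⟨V' ⊓ MulAut.conj g • V, hV'.inter (isOpen_conj_smul g hV), fun l hl hlV => ?_⟩
    have := hn _ (mem_conj_smul.1 (hVg ⟨hl, hlV.1⟩)) (mem_conj_smul.1 hlV.2)
    calc g * n * g⁻¹ * l = g * (n * (g⁻¹ * l * g)) * g⁻¹ := by group
      _ = g * ((g⁻¹ * l * g) * n) * g⁻¹ := by rw [this]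
      _ = _ := by group
  have hxN : x ∈ N := ⟨⊤, isOpen_univ, fun l hl _ => (Subgroup.mem_centralizer_iff.1 hx l hl).symm⟩
  have hNd := topologicalClosure_eq_top_of_normal (N := N)
    (fun h => hx1 (by rw [h] at hxN; exact hxN))
  obtain ⟨U, hUc, hUo, hUL⟩ := exists_compact_open_subgroup_le L.isOpen_normalizer
  obtain ⟨F, hF, hFt⟩ := exists_finset_closure_eq_top hNd hUo
  choose! V hVo hV using hF
  -- Inside this neighbourhood every generator in `F` commutes with `L ⊓ W`. Excluding `x`
  -- guarantees that `L ⊓ W` is proper once it is known to be normal.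
  have hO : IsOpen (((⨅ n : F, V n : Subgroup G) : Set G) ∩ {x}ᶜ) := by
    rw [Subgroup.coe_iInf]
    exact (isOpen_iInter_of_finite fun n : F => hVo n n.2).inter isOpen_compl_singleton
  obtain ⟨W, -, hWc, hWo, hWV, hUW⟩ := exists_open_subgroup_le_normalizer hUc hUo
    (hO.mem_nhds ⟨Subgroup.one_mem _, by simpa using hx1.symm⟩)
  have htop : Subgroup.normalizer ((L.toSubgroup ⊓ W : Subgroup G) : Set G) = ⊤ := by
    rw [eq_top_iff, ← hFt, Subgroup.closure_le]
    rintro g (hg | hg)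
    · exact le_normalizer_inf hUL hUW hg
    · have hcomm : ∀ l ∈ L.toSubgroup ⊓ W, g * l = l * g := fun l hl =>
        hV g hg l hl.1 ((Subgroup.mem_iInf.1 (hWV hl.2).1) ⟨g, hg⟩)
      refine Subgroup.mem_normalizer_iff.2 fun l => ⟨fun hl => ?_, fun hl => ?_⟩
      · rw [hcomm l hl, mul_inv_cancel_right]
        exact hl
      · have := hcomm _ hl
        have h2 : l = g * l * g⁻¹ := by
          rw [← mul_assoc, ← mul_assoc] at this
          have h3 : g * (g * l * g⁻¹) = g * l := by simpa [mul_assoc] using this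
          exact (mul_left_cancel h3).symm
        rw [h2]
        exact hl
  have hbot : L.toSubgroup ⊓ W = ⊥ := by
    refine eq_bot_of_normal_of_isClosed (Subgroup.normalizer_eq_top_iff.1 htop)
      (L.isCompact.isClosed.inter hWc.isClosed) (x := x) fun h => ?_
    exact (hWV h.2).2 rfl
  exact le_bot_iff.1 (LN.mk_le_mk_iff_exists_open.2 ⟨W, hWo, hbot.le⟩)

/-- The quasi-centre of `G` is trivial. -/
theorem eq_one_of_forall_mem_open {V : Subgroup G} (hV : IsOpen (V : Set G)) {x : G}
    (hx : ∀ v ∈ V, v * x = x * v) : x = 1 := by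
  by_contra h1
  obtain ⟨U, hUc, hUo, hUV⟩ := exists_compact_open_subgroup_le hV
  have h : LN.mk (LocallyNormal.ofOpen U hUc hUo) = ⊥ := by
    refine LN.mk_eq_bot_of_forall_smul_eq (fun g => ?_) (x := x)
      (Subgroup.mem_centralizer_iff.2 fun v hv => hx v (hUV hv)) h1
    rw [LN.smul_mk]
    exact (LN.mk_ofOpen _ (isCompact_conj_smul g hUc) (isOpen_conj_smul g hUo)).trans
      (LN.mk_ofOpen _ _ _).symm
  obtain ⟨W, hWo, hW⟩ := LN.mk_le_mk_iff_exists_open.1 h.le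
  exact ne_bot_of_isOpen (hUo.inter hWo : IsOpen ((U ⊓ W : Subgroup G) : Set G))
    (le_bot_iff.1 hW)

/-- A locally normal subgroup that meets an open subgroup trivially is trivial. -/
theorem LocallyNormal.eq_bot_of_inf_eq_bot {K : LocallyNormal G} {V : Subgroup G}
    (hV : IsOpen (V : Set G)) (h : K.toSubgroup ⊓ V = ⊥) : K.toSubgroup = ⊥ := by
  obtain ⟨V', hVc', hVo', hV'⟩ := exists_compact_open_subgroup_le
    (O := V ⊓ Subgroup.normalizer (K.toSubgroup : Set G)) (hV.inter K.isOpen_normalizer)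
  have hVK := hV'.trans inf_le_right
  -- `W` is normalised by the compact open group `K V'` and meets `K` trivially, so `K` and `W`
  -- commute and `K` lies in the quasi-centre.
  obtain ⟨W, -, -, hWo, hWV, hUW⟩ := exists_open_subgroup_le_normalizer
    (isCompact_sup K.isCompact hVc' hVK) (Subgroup.isOpen_mono le_sup_right hVo')
    (hVo'.mem_nhds V'.one_mem)
  refine (Subgroup.eq_bot_iff_forall _).2 fun k hk => eq_one_of_forall_mem_open hWo fun w hw => ?_
  refine (mul_comm_of_inf_eq_bot (K := K.toSubgroup) (L := W) ?_ hk hw ?_ ?_).symm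
  · exact le_bot_iff.1 (h ▸ inf_le_inf_left _ (fun x hx => (hV' (hWV hx)).1))
  · exact hUW (Subgroup.mem_sup_left hk)
  · exact hVK (hWV hw)

/-- Being commensurable with the trivial group only means being finite; triviality of the
quasi-centre excludes nontrivial finite locally normal subgroups. This turns lattice disjointness
into trivial intersection of any representatives. -/
theorem LN.mk_eq_bot_iff {K : LocallyNormal G} : LN.mk K = ⊥ ↔ K.toSubgroup = ⊥ := by
  constructor
  · intro h
    obtain ⟨W, hWo, hW⟩ := LN.mk_le_mk_iff_exists_open.1 h.le
    exact LocallyNormal.eq_bot_of_inf_eq_bot hWo (le_bot_iff.1 hW)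
  · intro h
    exact congrArg LN.mk (LocallyNormal.ext h : K = LocallyNormal.trivial G)

end DenseGeneration

/-! ### Finite generation and finite joins of subgroups -/

section Groups

variable {G : Type u} [Group G]

theorem conj_smul_eq_of_mem_normalizer {K : Subgroup G} {x : G}
    (hx : x ∈ Subgroup.normalizer (K : Set G)) : MulAut.conj x • K = K := by
  ext y
  rw [mem_conj_smul]
  have := Subgroup.mem_normalizer_iff.1 (Subgroup.inv_mem _ hx) y
  simpa using this.symm

theorem exists_finset_mem_closure {S : Set G} {x : G} (hx : x ∈ Subgroup.closure S) :
    ∃ X : Finset G, (X : Set G) ⊆ S ∧ x ∈ Subgroup.closure (X : Set G) := by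
  classical
  induction hx using Subgroup.closure_induction with
  | mem x hx => exact ⟨{x}, by simpa using hx, Subgroup.subset_closure (by simp)⟩
  | one => exact ⟨∅, by simp, Subgroup.one_mem _⟩
  | mul x y _ _ hx hy =>
    obtain ⟨X, hX, hxX⟩ := hx
    obtain ⟨Y, hY, hyY⟩ := hy
    refine ⟨X ∪ Y, by simp [hX, hY], Subgroup.mul_mem _ ?_ ?_⟩
    · exact Subgroup.closure_mono (by simp) hxX
    · exact Subgroup.closure_mono (by simp) hyY
  | inv x _ hx =>
    obtain ⟨X, hX, hxX⟩ := hx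
    exact ⟨X, hX, Subgroup.inv_mem _ hxX⟩

theorem le_normalizer_finset_sup {ι : Type*} {U : Subgroup G} {T : Finset ι} {f : ι → Subgroup G}
    (h : ∀ u ∈ U, ∀ t ∈ T, ∀ k ∈ f t, u * k * u⁻¹ ∈ T.sup f) :
    U ≤ Subgroup.normalizer ((T.sup f : Subgroup G) : Set G) := by
  refine Subgroup.le_normalizer_iff.2 fun u hu k hk => ?_
  have : T.sup f ≤ (T.sup f).comap (MulAut.conj u).toMonoidHom :=
    Finset.sup_le fun t ht k hk => h u hu t ht k hk
  exact this hk

theorem isCompact_finset_sup [TopologicalSpace G] [IsTopologicalGroup G] {ι : Type*}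
    {V : Subgroup G} {T : Finset ι} {f : ι → Subgroup G} (hV : ∀ t ∈ T, f t ≤ V)
    (hn : ∀ t ∈ T, V ≤ Subgroup.normalizer (f t : Set G))
    (hc : ∀ t ∈ T, IsCompact (f t : Set G)) : IsCompact ((T.sup f : Subgroup G) : Set G) := by
  classical
  induction T using Finset.induction_on with
  | empty => simp
  | insert t T ht ih =>
    simp only [Finset.mem_insert, forall_eq_or_imp] at hV hn hc
    rw [Finset.sup_insert]
    exact isCompact_sup hc.1 (ih hV.2 hn.2 hc.2) ((Finset.sup_le hV.2).trans hn.1)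

end Groups

/-! ### Invariant joins of conjugates and their consequences -/

variable {G : Type u} [Group G] [TopologicalSpace G] [ClassS G]

/-- Finitely many conjugates of a nontrivial locally normal subgroup have a join (after intersecting
with a compact open subgroup) whose class is fixed by `G`. -/
theorem exists_finset_conj_join_fixed (A : LocallyNormal G) (hA : A.toSubgroup ≠ ⊥) :
    ∃ (T : Finset G) (V : Subgroup G) (B : LocallyNormal G), IsOpen (V : Set G) ∧
      (∀ t ∈ T, V ≤ Subgroup.normalizer ((A.conj t).toSubgroup : Set G)) ∧
      B.toSubgroup = T.sup (fun t => (A.conj t).toSubgroup ⊓ V) ∧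
      (∀ g : G, g • LN.mk B = LN.mk B) ∧ B.toSubgroup ≠ ⊥ := by
  classical
  obtain ⟨U, hUc, hUo⟩ := exists_compact_open_subgroup G
  have hN : Subgroup.normalClosure (A.toSubgroup : Set G) ≠ ⊥ := fun h =>
    hA (le_bot_iff.1 (h ▸ Subgroup.le_normalClosure))
  obtain ⟨F, hF, hFt⟩ := exists_finset_closure_eq_top (topologicalClosure_eq_top_of_normal hN) hUo
  -- Elements of the normal closure are words in elements of conjugates of `A`, so each generator
  -- other than those in `U` can be taken inside some conjugate.
  have hX : ∃ X : Finset G, (∀ x ∈ X, ∃ g : G, x ∈ MulAut.conj g • A.toSubgroup) ∧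
      Subgroup.closure ((U : Set G) ∪ X) = ⊤ := by
    choose! Y hY hFY using fun f (hf : f ∈ F) => exists_finset_mem_closure (hF f hf)
    refine ⟨F.biUnion Y, fun x hx => ?_, ?_⟩
    · obtain ⟨f, hf, hx⟩ := Finset.mem_biUnion.1 hx
      obtain ⟨a, ha, hax⟩ := Group.mem_conjugatesOfSet_iff.1 (hY f hf hx)
      obtain ⟨c, rfl⟩ := isConj_iff.1 hax
      exact ⟨c, mem_conj_smul.2 (by simpa [mul_assoc] using ha)⟩
    · rw [eq_top_iff, ← hFt, Subgroup.closure_le, Set.union_subset_iff]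
      refine ⟨fun u hu => Subgroup.subset_closure (Or.inl hu), fun f hf => ?_⟩
      refine Subgroup.closure_mono ?_ (hFY f hf)
      exact fun y hy => Or.inr (Finset.mem_biUnion.2 ⟨f, hf, hy⟩)
  obtain ⟨X, hX, hXt⟩ := hX
  choose! γ hγ using hX
  let T₀ : Finset G := insert 1 (X.image γ)
  let V₀ : Subgroup G := U ⊓ ⨅ t : T₀, Subgroup.normalizer ((A.conj (t : G)).toSubgroup : Set G)
  have hV₀ : IsOpen (V₀ : Set G) := by
    rw [Subgroup.coe_inf, Subgroup.coe_iInf]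
    exact hUo.inter (isOpen_iInter_of_finite fun t : T₀ => (A.conj (t : G)).isOpen_normalizer)
  obtain ⟨C, hC⟩ := hUc.elim_finite_subcover (fun c : G => {x : G | c⁻¹ * x ∈ V₀})
    (fun c => hV₀.preimage (continuous_const_mul _))
    (fun x _ => Set.mem_iUnion.2 ⟨x, by simp [V₀.one_mem]⟩)
  -- Representatives in `U` for the cosets of `V₀`. Multiplying `T₀` by them makes `U` permute the
  -- conjugates of `A` indexed by `T`.
  let C' : Finset G := insert 1 (C.filter (· ∈ U))
  let T : Finset G := C' * T₀
  have hC' : ∀ c ∈ C', c ∈ U := by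
    intro c hc
    rcases Finset.mem_insert.1 hc with rfl | hc
    · exact U.one_mem
    · exact (Finset.mem_filter.1 hc).2
  have hT₀ : ∀ t ∈ T₀, t ∈ T := fun t ht =>
    Finset.mem_mul.2 ⟨1, Finset.mem_insert_self _ _, t, ht, one_mul t⟩
  have hCU : ∀ u ∈ U, ∃ c ∈ C, c⁻¹ * u ∈ V₀ := fun u hu => by
    simpa using hC hu
  have hperm : ∀ u ∈ U, ∀ t ∈ T, ∃ t' ∈ T, MulAut.conj u • (A.conj t).toSubgroup =
      (A.conj t').toSubgroup := by
    intro u hu t ht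
    obtain ⟨c, hc, s, hs, rfl⟩ := Finset.mem_mul.1 ht
    obtain ⟨c', hc', hcu⟩ := hCU (u * c) (U.mul_mem hu (hC' c hc))
    have hc'U : c' ∈ U := by
      have := U.mul_mem (U.mul_mem hu (hC' c hc)) (U.inv_mem hcu.1)
      simpa [mul_assoc] using this
    refine ⟨c' * s, Finset.mul_mem_mul (Finset.mem_insert_of_mem
      (Finset.mem_filter.2 ⟨hc', hc'U⟩)) hs, ?_⟩
    have := conj_smul_eq_of_mem_normalizer (Subgroup.mem_iInf.1 hcu.2 ⟨s, hs⟩)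
    simp only [LocallyNormal.conj, map_mul, mul_smul, map_inv, inv_smul_eq_iff] at this ⊢
    exact this
  have hV₁ : IsOpen ((⨅ t : T, Subgroup.normalizer ((A.conj (t : G)).toSubgroup : Set G) :
      Subgroup G) : Set G) := by
    rw [Subgroup.coe_iInf]
    exact isOpen_iInter_of_finite fun t : T => (A.conj (t : G)).isOpen_normalizer
  obtain ⟨V, hVU, hVc, hVo, hV, hUV⟩ := exists_open_subgroup_le_normalizer hUc hUo
    (hV₁.mem_nhds (Subgroup.one_mem _))
  have hVA : ∀ t ∈ T, V ≤ Subgroup.normalizer ((A.conj t).toSubgroup : Set G) :=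
    fun t ht v hv => Subgroup.mem_iInf.1 (hV hv) ⟨t, ht⟩
  set f : G → Subgroup G := fun t => (A.conj t).toSubgroup ⊓ V with hf
  have hUB : U ≤ Subgroup.normalizer ((T.sup f : Subgroup G) : Set G) := by
    refine le_normalizer_finset_sup fun u hu t ht k hk => ?_
    obtain ⟨t', ht', h⟩ := hperm u hu t ht
    refine Finset.le_sup (f := f) ht' ⟨?_, conj_mem_of_le_normalizer hUV hu hk.2⟩
    rw [← h]
    exact mem_conj_smul.2 (by simpa [mul_assoc] using hk.1)
  have hBV : T.sup f ≤ V := Finset.sup_le fun t _ => inf_le_right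
  let B : LocallyNormal G :=
    { toSubgroup := T.sup f
      isCompact := isCompact_finset_sup (fun t _ => inf_le_right)
        (fun t ht => le_normalizer_inf (hVA t ht) Subgroup.le_normalizer)
        (fun t _ => (A.conj t).isCompact.inter_right hVc.isClosed)
      isOpen_normalizer := Subgroup.isOpen_mono hUB hUo }
  -- For `b ∈ B` the commutator of `x` and `b` lies in the conjugate of `A`, which `b` normalises.
  -- If `x b x⁻¹` is in `V`, the commutator lies in `B`, and so does `x b x⁻¹`.
  have hx : ∀ t ∈ T, ∀ x ∈ (A.conj t).toSubgroup, x • LN.mk B ≤ LN.mk B := by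
    intro t ht x hx
    refine LN.mk_le_mk_iff_exists_open.2 ⟨V, hVo, fun y hy => ?_⟩
    obtain ⟨b, hb, rfl⟩ : ∃ b ∈ T.sup f, x * b * x⁻¹ = y := by
      refine ⟨x⁻¹ * y * x, mem_conj_smul.1 hy.1, by group⟩
    have h1 : x * b * x⁻¹ * b⁻¹ ∈ f t := by
      refine ⟨?_, V.mul_mem hy.2 (V.inv_mem (hBV hb))⟩
      have := Subgroup.mul_mem _ hx
        (conj_mem_of_le_normalizer (hVA t ht) (hBV hb) (Subgroup.inv_mem _ hx))
      simpa [mul_assoc] using this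
    have := Subgroup.mul_mem _ (Finset.le_sup (f := f) ht h1) hb
    simpa using this
  refine ⟨T, V, B, hVo, hVA, rfl, fun g => ?_, fun h => ?_⟩
  · suffices h : MulAction.stabilizer G (LN.mk B) = ⊤ from
      MulAction.mem_stabilizer_iff.1 (h ▸ Subgroup.mem_top g)
    rw [eq_top_iff, ← hXt, Subgroup.closure_le]
    rintro g (hg | hg)
    · exact congrArg LN.mk (LocallyNormal.ext (conj_smul_eq_of_mem_normalizer (hUB hg)))
    · have hgT : γ g ∈ T := hT₀ _ (Finset.mem_insert_of_mem (Finset.mem_image_of_mem γ hg))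
      refine le_antisymm (hx _ hgT g (hγ g hg)) ?_
      have := LN.smul_le_smul g (hx _ hgT g⁻¹ (Subgroup.inv_mem _ (hγ g hg)))
      rwa [smul_inv_smul] at this
  · have h1 : f 1 ≤ ⊥ := (Finset.le_sup (f := f) (hT₀ 1 (Finset.mem_insert_self _ _))).trans_eq h
    have h2 := LocallyNormal.eq_bot_of_inf_eq_bot hVo (le_bot_iff.1 h1)
    refine hA ?_
    simpa [LocallyNormal.conj] using h2

/-- Abelian locally normal subgroups are trivial. -/
theorem LocallyNormal.eq_bot_of_comm {A : LocallyNormal G}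
    (hA : ∀ a ∈ A.toSubgroup, ∀ b ∈ A.toSubgroup, a * b = b * a) : A.toSubgroup = ⊥ := by
  classical
  by_contra hA1
  obtain ⟨T, V, B, hVo, hVA, hB, hfix, hB1⟩ := exists_finset_conj_join_fixed A hA1
  -- Take `S` maximal such that `V` and the conjugates indexed by `S` share some `x ≠ 1`. Then `x`
  -- centralises `B`: the conjugates in `S` are abelian, and for the others a nontrivial commutator
  -- with `x` would enlarge `S`.
  let P : Finset G → Prop := fun S => ∃ x ∈ V, x ≠ 1 ∧ ∀ s ∈ S, x ∈ (A.conj s).toSubgroup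
  have hP : P ∅ := by
    obtain ⟨x, hx, hx1⟩ := V.bot_or_exists_ne_one.resolve_left (ne_bot_of_isOpen hVo)
    exact ⟨x, hx, hx1, by simp⟩
  obtain ⟨S, hS, hmax⟩ := Finset.exists_max_image (T.powerset.filter P) Finset.card
    ⟨∅, by simp [hP]⟩
  obtain ⟨hST, x, hxV, hx1, hxS⟩ := Finset.mem_filter.1 hS
  refine hB1 (LN.mk_eq_bot_iff.1 (LN.mk_eq_bot_of_forall_smul_eq hfix (x := x) ?_ hx1))
  have : B.toSubgroup ≤ Subgroup.centralizer {x} := by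
    rw [hB]
    refine Finset.sup_le fun t ht y hy => Subgroup.mem_centralizer_singleton_iff.2 ?_
    by_cases htS : t ∈ S
    · have h1 := mem_conj_smul.1 (hxS t htS)
      have h2 := mem_conj_smul.1 hy.1
      have := hA _ h1 _ h2
      have h3 : t⁻¹ * (x * y) * t = t⁻¹ * (y * x) * t := by
        simpa [mul_assoc] using this
      simpa using h3.symm
    · by_contra hne
      have hz : P (insert t S) := by
        refine ⟨y * x * y⁻¹ * x⁻¹, ?_, ?_, fun s hs => ?_⟩
        · exact V.mul_mem (V.mul_mem (V.mul_mem hy.2 hxV) (V.inv_mem hy.2)) (V.inv_mem hxV)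
        · intro h
          exact hne (mul_inv_eq_iff_eq_mul.1 (mul_inv_eq_one.1 h))
        · rcases Finset.mem_insert.1 hs with rfl | hs
          · have := Subgroup.mul_mem _ hy.1
              (conj_mem_of_le_normalizer (hVA s ht) hxV (Subgroup.inv_mem _ hy.1))
            simpa [mul_assoc] using this
          · exact Subgroup.mul_mem _ (conj_mem_of_le_normalizer
              (hVA s (Finset.mem_powerset.1 hST hs)) hy.2 (hxS s hs))
              (Subgroup.inv_mem _ (hxS s hs))
      have h1 := hmax (insert t S) (Finset.mem_filter.2 ⟨Finset.mem_powerset.2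
        (Finset.insert_subset ht (Finset.mem_powerset.1 hST)), hz⟩)
      rw [Finset.card_insert_of_notMem htS] at h1
      omega
  exact Subgroup.mem_centralizer_iff.2 fun b hb =>
    (Subgroup.mem_centralizer_singleton_iff.1 (this hb))

/-- If locally normal subgroups `K` and `L` intersect trivially, then an open subgroup of `L`
centralises `K`. -/
theorem LocallyNormal.exists_open_inf_le_centralizer {K L : LocallyNormal G}
    (h : K.toSubgroup ⊓ L.toSubgroup = ⊥) : ∃ W : Subgroup G, IsOpen (W : Set G) ∧
      L.toSubgroup ⊓ W ≤ Subgroup.centralizer (K.toSubgroup : Set G) := by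
  obtain ⟨V, hVc, hVo, hV⟩ := exists_compact_open_subgroup_le
    (O := Subgroup.normalizer (K.toSubgroup : Set G) ⊓ Subgroup.normalizer (L.toSubgroup : Set G))
    (K.isOpen_normalizer.inter L.isOpen_normalizer)
  have hVK := hV.trans inf_le_left
  have hVL := hV.trans inf_le_right
  have hUo : IsOpen ((K.toSubgroup ⊔ V : Subgroup G) : Set G) :=
    Subgroup.isOpen_mono le_sup_right hVo
  have hUK : K.toSubgroup ⊔ V ≤ Subgroup.normalizer (K.toSubgroup : Set G) :=
    sup_le Subgroup.le_normalizer hVK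
  obtain ⟨W, hWU, hWc, hWo, hWV, hUW⟩ := exists_open_subgroup_le_normalizer
    (isCompact_sup K.isCompact hVc hVK) hUo (hVo.mem_nhds V.one_mem)
  have hUKW := le_normalizer_inf hUK hUW
  have hUM := le_normalizer_inf hUW (le_normalizer_centralizer hUKW)
  -- The part of `K` inside the centraliser of `K ⊓ W` in `W` is abelian, hence trivial.
  have hbot : K.toSubgroup ⊓
      (W ⊓ Subgroup.centralizer ((K.toSubgroup ⊓ W : Subgroup G) : Set G)) = ⊥ := by
    refine LocallyNormal.eq_bot_of_comm (A := ⟨_, ?_, Subgroup.isOpen_mono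
      (le_normalizer_inf hUK hUM) hUo⟩) ?_
    · exact K.isCompact.inter_right (hWc.isClosed.inter (Set.isClosed_centralizer _))
    · intro a ha b hb
      exact Subgroup.mem_centralizer_iff.1 hb.2.2 a ⟨ha.1, ha.2.1⟩
  -- `l` commutes with `K ⊓ W` because `K` and `L` meet trivially, so it lies in the centraliser
  -- considered in `hbot`. The same commutator argument, applied to that centraliser and `K`, shows
  -- that `l` commutes with all of `K`.
  refine ⟨W, hWo, fun l hl => Subgroup.mem_centralizer_iff.2 fun k hk => ?_⟩
  refine mul_comm_of_inf_eq_bot hbot hk ⟨hl.2, ?_⟩ (hUM (Subgroup.mem_sup_left hk))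
    (hVK (hWV hl.2))
  exact Subgroup.mem_centralizer_iff.2 fun k' hk' =>
    mul_comm_of_inf_eq_bot h hk'.1 hl.1 (hVL (hWV hk'.2)) (hVK (hWV hl.2))

/-- Finitely many conjugates of a nontrivial locally normal subgroup suffice to meet every
nontrivial locally normal subgroup. -/
theorem LocallyNormal.exists_finset_conj_inf_ne_bot (A : LocallyNormal G)
    (hA : A.toSubgroup ≠ ⊥) : ∃ T : Finset G, ∀ L : LocallyNormal G, L.toSubgroup ≠ ⊥ →
      ∃ t ∈ T, (A.conj t).toSubgroup ⊓ L.toSubgroup ≠ ⊥ := by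
  obtain ⟨T, V, B, hVo, hVA, hB, hfix, hB1⟩ := exists_finset_conj_join_fixed A hA
  refine ⟨T, fun L hL => ?_⟩
  by_contra! h
  choose! W hWo hW using fun t ht => LocallyNormal.exists_open_inf_le_centralizer (h t ht)
  have ho : IsOpen ((⨅ t : T, W t : Subgroup G) : Set G) := by
    rw [Subgroup.coe_iInf]
    exact isOpen_iInter_of_finite fun t : T => hWo t t.2
  obtain ⟨x, hx, hx1⟩ := (Subgroup.bot_or_exists_ne_one _).resolve_left
    (fun h => hL (LocallyNormal.eq_bot_of_inf_eq_bot ho h))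
  refine hB1 (LN.mk_eq_bot_iff.1 (LN.mk_eq_bot_of_forall_smul_eq hfix (x := x) ?_ hx1))
  have : B.toSubgroup ≤ Subgroup.centralizer {x} := by
    rw [hB]
    refine Finset.sup_le fun t ht y hy => Subgroup.mem_centralizer_singleton_iff.2 ?_
    exact Subgroup.mem_centralizer_iff.1
      (hW t ht ⟨hx.1, Subgroup.mem_iInf.1 hx.2 ⟨t, ht⟩⟩) y hy.1
  exact Subgroup.mem_centralizer_iff.2 fun b hb =>
    (Subgroup.mem_centralizer_singleton_iff.1 (this hb))

/-! ### Meets and pseudocomplements in the structure lattice -/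

namespace LN

theorem mk_le_mk_of_le {H : Type u} [Group H] [TopologicalSpace H] {K L : LocallyNormal H}
    (h : K.toSubgroup ≤ L.toSubgroup) : mk K ≤ mk L :=
  ⟨K, L, rfl, rfl, h⟩

theorem mk_inf_le_mk_inf {K K' L L' : LocallyNormal G} (hK : mk K ≤ mk K') (hL : mk L ≤ mk L') :
    mk (K.inf L) ≤ mk (K'.inf L') := by
  obtain ⟨V, hV, hVK⟩ := mk_le_mk_iff_exists_open.1 hK
  obtain ⟨W, hW, hWL⟩ := mk_le_mk_iff_exists_open.1 hL
  exact mk_le_mk_iff_exists_open.2 ⟨V ⊓ W, hV.inter hW, fun x hx =>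
    ⟨hVK ⟨hx.1.1, hx.2.1⟩, hWL ⟨hx.1.2, hx.2.2⟩⟩⟩

/-- The structure lattice is a meet-semilattice. -/
instance : SemilatticeInf (LN G) where
  inf := Quotient.map₂ LocallyNormal.inf fun _ _ hK _ _ hL => mk_eq_mk.1 <|
    le_antisymm (mk_inf_le_mk_inf (mk_eq_mk.2 hK).le (mk_eq_mk.2 hL).le)
      (mk_inf_le_mk_inf (mk_eq_mk.2 hK).ge (mk_eq_mk.2 hL).ge)
  inf_le_left := ind fun _ => ind fun _ => mk_le_mk_of_le inf_le_left
  inf_le_right := ind fun _ => ind fun _ => mk_le_mk_of_le inf_le_right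
  le_inf := ind fun K => ind fun L => ind fun M hL hM => by
    have h := mk_inf_le_mk_inf hL hM
    have : K.inf K = K := LocallyNormal.ext (inf_idem K.toSubgroup)
    rwa [this] at h

theorem mk_inf_mk_eq_bot_iff {K L : LocallyNormal G} :
    mk K ⊓ mk L = ⊥ ↔ K.toSubgroup ⊓ L.toSubgroup = ⊥ :=
  mk_eq_bot_iff (K := K.inf L)

theorem exists_isPerp (α : LN G) : ∃ β, IsPerp α β := by
  induction α using ind with
  | h K =>
    obtain ⟨V, hVc, hVo, hV⟩ := exists_compact_open_subgroup_le K.isOpen_normalizer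
    exact ⟨_, K, K.toSubgroup ⊔ V, isCompact_sup K.isCompact hVc hV,
      Subgroup.isOpen_mono le_sup_right hVo, le_sup_left, sup_le Subgroup.le_normalizer hV,
      rfl, rfl⟩

/-- `α^⊥` is the pseudocomplement of `α`. -/
theorem IsPerp.le_iff {α β γ : LN G} (h : IsPerp α β) : γ ≤ β ↔ γ ⊓ α = ⊥ := by
  obtain ⟨K, U, hc, ho, hKU, hn, rfl, rfl⟩ := h
  induction γ using ind with
  | h L =>
  constructor
  · intro h
    refine le_bot_iff.1 ((inf_le_inf_right (mk K) h).trans_eq (mk_inf_mk_eq_bot_iff.2 ?_))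
    refine LocallyNormal.eq_bot_of_comm
      (A := (LocallyNormal.centralizerIn U K.toSubgroup hc ho hn).inf K) fun a ha b hb => ?_
    exact (Subgroup.mem_centralizer_iff.1 ha.1.2 b hb.2).symm
  · intro h
    rw [mk_inf_mk_eq_bot_iff, inf_comm] at h
    obtain ⟨W, hWo, hW⟩ := LocallyNormal.exists_open_inf_le_centralizer h
    exact mk_le_mk_iff_exists_open.2 ⟨U ⊓ W, ho.inter hWo, fun x hx =>
      ⟨hx.2.1, hW ⟨hx.1, hx.2.2⟩⟩⟩

/-- The pseudocomplement `α^⊥`. -/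
noncomputable def perp (α : LN G) : LN G := (exists_isPerp α).choose

theorem isPerp_perp (α : LN G) : IsPerp α (perp α) := (exists_isPerp α).choose_spec

theorem le_perp_iff {α γ : LN G} : γ ≤ perp α ↔ γ ⊓ α = ⊥ := (isPerp_perp α).le_iff

theorem le_perp_comm {α γ : LN G} : γ ≤ perp α ↔ α ≤ perp γ := by
  rw [le_perp_iff, le_perp_iff, inf_comm]

theorem le_perp_perp (α : LN G) : α ≤ perp (perp α) := le_perp_comm.1 le_rfl

theorem perp_anti {α β : LN G} (h : α ≤ β) : perp β ≤ perp α :=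
  le_perp_comm.1 (h.trans (le_perp_perp β))

theorem perp_perp_perp (α : LN G) : perp (perp (perp α)) = perp α :=
  le_antisymm (perp_anti (le_perp_perp α)) (le_perp_perp _)

theorem inf_perp (α : LN G) : α ⊓ perp α = ⊥ := by
  rw [inf_comm]
  exact le_perp_iff.1 le_rfl

/-- The identity `α^⊥⊥⊥ = α^⊥` makes the centraliser lattice the set of closed elements of a
pseudocomplemented semilattice. Such a set is Boolean by Glivenko's argument. -/
theorem mem_LC_iff {β : LN G} : β ∈ LC G ↔ perp (perp β) = β := by
  constructor
  · rintro ⟨α, h⟩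
    have : β = perp α :=
      le_antisymm (le_perp_iff.2 (h.le_iff.1 le_rfl)) (h.le_iff.2 (le_perp_iff.1 le_rfl))
    rw [this, perp_perp_perp]
  · intro h
    refine ⟨perp β, ?_⟩
    have := isPerp_perp (perp β)
    rwa [h] at this

theorem perp_mem_LC (α : LN G) : perp α ∈ LC G := ⟨α, isPerp_perp α⟩

theorem perp_bot : perp (⊥ : LN G) = ⊤ := top_le_iff.1 (le_perp_iff.2 (inf_bot_eq _))

theorem perp_top : perp (⊤ : LN G) = ⊥ := by
  have := inf_perp (⊤ : LN G)
  rwa [top_inf_eq] at this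

end LN

/-! ### The Boolean structure of the centraliser lattice -/

open LN

theorem inf_mem_LC {β γ : LN G} (hβ : β ∈ LC G) (hγ : γ ∈ LC G) : β ⊓ γ ∈ LC G := by
  rw [mem_LC_iff] at *
  refine le_antisymm (le_inf ?_ ?_) (le_perp_perp _)
  · exact (perp_anti (perp_anti inf_le_left)).trans_eq hβ
  · exact (perp_anti (perp_anti inf_le_right)).trans_eq hγ

/-- The centraliser lattice is a Boolean lattice. -/
noncomputable instance : BooleanAlgebra (LC G) where
  toPartialOrder := inferInstance
  sup β γ := ⟨perp (perp β.1 ⊓ perp γ.1), perp_mem_LC _⟩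
  inf β γ := ⟨β.1 ⊓ γ.1, inf_mem_LC β.2 γ.2⟩
  compl β := ⟨perp β.1, perp_mem_LC _⟩
  top := ⟨⊤, perp_bot (G := G) ▸ perp_mem_LC _⟩
  bot := ⟨⊥, perp_top (G := G) ▸ perp_mem_LC _⟩
  le_sup_left β γ := le_perp_comm.1 (inf_le_left (a := perp β.1))
  le_sup_right β γ := le_perp_comm.1 (inf_le_right (b := perp γ.1))
  sup_le β γ δ hβ hγ := (perp_anti (le_inf (perp_anti hβ) (perp_anti hγ))).trans_eq
    (mem_LC_iff.1 δ.2)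
  inf_le_left β γ := inf_le_left (a := β.1)
  inf_le_right β γ := inf_le_right (a := β.1)
  le_inf β γ δ hγ hδ := SemilatticeInf.le_inf β.1 γ.1 δ.1 hγ hδ
  le_top β := le_top (a := β.1)
  bot_le β := bot_le (a := β.1)
  inf_compl_le_bot β := (inf_perp β.1).le
  top_le_sup_compl β := by
    change (⊤ : LN G) ≤ perp (perp β.1 ⊓ perp (perp β.1))
    rw [inf_perp, perp_bot]
  le_sup_inf β γ δ := by
    change perp (perp β.1 ⊓ perp γ.1) ⊓ perp (perp β.1 ⊓ perp δ.1) ≤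
      perp (perp β.1 ⊓ perp (γ.1 ⊓ δ.1))
    rw [le_perp_iff, ← le_bot_iff]
    set x := perp (perp β.1 ⊓ perp γ.1) ⊓ perp (perp β.1 ⊓ perp δ.1) ⊓
      (perp β.1 ⊓ perp (γ.1 ⊓ δ.1)) with hx
    have hβ : x ≤ perp β.1 := inf_le_right.trans inf_le_left
    -- Since `x` already lies below the pseudocomplement of `β`, the assumption reduces to `x` being
    -- disjoint from that of `ε`; closedness of `ε` then gives `x ≤ ε`.
    have key : ∀ ε : LC G, x ≤ perp (perp β.1 ⊓ perp ε.1) → x ≤ ε.1 := by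
      intro ε h
      rw [← mem_LC_iff.1 ε.2, le_perp_iff]
      rw [le_perp_iff, ← inf_assoc, inf_eq_left.2 hβ] at h
      exact h
    have h1 := key γ (inf_le_left.trans inf_le_left)
    have h2 := key δ (inf_le_left.trans inf_le_right)
    have h3 : x ≤ perp (γ.1 ⊓ δ.1) := inf_le_right.trans inf_le_right
    exact (le_inf (le_inf h1 h2) h3).trans_eq (inf_perp _)

/-! ### The action on the centraliser lattice and rigid stabilisers -/

namespace LC

theorem coe_bot : ((⊥ : LC G) : LN G) = ⊥ := rfl

theorem coe_top : ((⊤ : LC G) : LN G) = ⊤ := rfl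

theorem coe_inf (β γ : LC G) : ((β ⊓ γ : LC G) : LN G) = β.1 ⊓ γ.1 := rfl

theorem coe_smul (g : G) (β : LC G) : ((g • β : LC G) : LN G) = g • β.1 := rfl

theorem eq_bot_iff {β : LC G} : β = ⊥ ↔ β.1 = ⊥ := Subtype.ext_iff

/-- The action of an element of `G` on `LC(G)`, as an order isomorphism. -/
def smulIso (g : G) : LC G ≃o LC G where
  toEquiv := MulAction.toPerm g
  map_rel_iff' {β γ} := ⟨fun h => by simpa using LC.smul_le_smul g⁻¹ h, LC.smul_le_smul g⟩

theorem smul_le_smul_iff {g : G} {β γ : LC G} : g • β ≤ g • γ ↔ β ≤ γ := (smulIso g).le_iff_le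

theorem smul_inf (g : G) (β γ : LC G) : g • (β ⊓ γ) = g • β ⊓ g • γ := (smulIso g).map_inf β γ

theorem smul_bot (g : G) : g • (⊥ : LC G) = ⊥ := (smulIso g).map_bot

theorem smul_top (g : G) : g • (⊤ : LC G) = ⊤ := (smulIso g).map_top

theorem smul_compl (g : G) (β : LC G) : g • βᶜ = (g • β)ᶜ :=
  ((smulIso g).isCompl isCompl_compl).compl_eq.symm

theorem smul_eq_bot_iff {g : G} {β : LC G} : g • β = ⊥ ↔ β = ⊥ :=
  map_eq_bot_iff (smulIso g)

theorem exists_mk (β : LC G) : ∃ K : LocallyNormal G, mk K = β.1 := Quotient.exists_rep β.1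

/-- The normaliser of any representative fixes the class. This lets density arguments in `G` act on
`LC(G)` and makes orbit maps locally constant. -/
theorem isOpen_stabilizer (β : LC G) : IsOpen (MulAction.stabilizer G β : Set G) := by
  obtain ⟨K, hK⟩ := exists_mk β
  refine Subgroup.isOpen_mono (fun g hg => ?_) K.isOpen_normalizer
  rw [MulAction.mem_stabilizer_iff]
  refine Subtype.ext ?_
  rw [coe_smul, ← hK, smul_mk]
  exact congrArg mk (LocallyNormal.ext (conj_smul_eq_of_mem_normalizer hg))

/-- The only elements of `LC(G)` fixed by `G` are `0` and `∞`. -/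
theorem eq_bot_or_eq_top_of_fixed {β : LC G} (hβ : ∀ g : G, g • β = β) : β = ⊥ ∨ β = ⊤ := by
  by_contra! h
  obtain ⟨L, hL⟩ := exists_mk β
  obtain ⟨M, hM⟩ := exists_mk βᶜ
  have hLM : L.toSubgroup ⊓ M.toSubgroup = ⊥ := by
    rw [← mk_inf_mk_eq_bot_iff, hL, hM, ← coe_inf, inf_compl_self, coe_bot]
  obtain ⟨W, hWo, hW⟩ := LocallyNormal.exists_open_inf_le_centralizer hLM
  have hM1 : M.toSubgroup ≠ ⊥ := by
    rw [← mk_eq_bot_iff.ne, hM, ← eq_bot_iff.ne]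
    exact compl_eq_bot.not.2 h.2
  obtain ⟨x, hx, hx1⟩ := (Subgroup.bot_or_exists_ne_one _).resolve_left
    fun h => hM1 (LocallyNormal.eq_bot_of_inf_eq_bot hWo h)
  refine h.1 (eq_bot_iff.2 (hL ▸ mk_eq_bot_of_forall_smul_eq (fun g => ?_) (hW hx) hx1))
  rw [hL, ← coe_smul, hβ]

theorem exists_finset_smul_inf_ne_bot {β : LC G} (hβ : β ≠ ⊥) :
    ∃ T : Finset G, ∀ γ : LC G, γ ≠ ⊥ → ∃ t ∈ T, t • β ⊓ γ ≠ ⊥ := by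
  obtain ⟨A, hA⟩ := exists_mk β
  have hA1 : A.toSubgroup ≠ ⊥ := by
    rwa [← mk_eq_bot_iff.ne, hA, ← eq_bot_iff.ne]
  obtain ⟨T, hT⟩ := A.exists_finset_conj_inf_ne_bot hA1
  refine ⟨T, fun γ hγ => ?_⟩
  obtain ⟨L, hL⟩ := exists_mk γ
  obtain ⟨t, ht, h⟩ := hT L (by rwa [← mk_eq_bot_iff.ne, hL, ← eq_bot_iff.ne])
  refine ⟨t, ht, fun h1 => h ?_⟩
  rw [← mk_inf_mk_eq_bot_iff, ← smul_mk, hA, hL, ← coe_smul, ← coe_inf, h1, coe_bot]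

/-- The rigid stabiliser of `β`: the elements that act trivially below the complement of `β`. -/
def rist (β : LC G) : Subgroup G where
  carrier := {g | ∀ δ : LC G, δ ⊓ β = ⊥ → g • δ = δ}
  one_mem' := by simp
  mul_mem' := by
    intro a b ha hb δ hδ
    rw [mul_smul, hb δ hδ, ha δ hδ]
  inv_mem' := by
    intro a ha δ hδ
    rw [inv_smul_eq_iff, ha δ hδ]

/-- A representative of an element disjoint from `β` can be shrunk, without changing its class,
until `k` centralises it. -/
theorem le_rist {K : LocallyNormal G} {β : LC G} (h : mk K = β.1) : K.toSubgroup ≤ rist β := by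
  intro k hk δ hδ
  obtain ⟨L, hL⟩ := exists_mk δ
  have hKL : K.toSubgroup ⊓ L.toSubgroup = ⊥ := by
    rw [← mk_inf_mk_eq_bot_iff, h, hL, ← coe_inf, inf_comm, hδ, coe_bot]
  obtain ⟨W, hWo, hW⟩ := LocallyNormal.exists_open_inf_le_centralizer hKL
  obtain ⟨V, hVc, hVo, hV⟩ := exists_compact_open_subgroup_le
    (O := W ⊓ Subgroup.normalizer (L.toSubgroup : Set G)) (hWo.inter L.isOpen_normalizer)
  have hLV : ∀ x ∈ L.toSubgroup ⊓ V, k * x = x * k := fun x hx =>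
    Subgroup.mem_centralizer_iff.1 (hW ⟨hx.1, (hV hx.2).1⟩) k hk
  let L' : LocallyNormal G := L.inf (.ofOpen V hVc hVo)
  have hL' : mk L' = mk L := le_antisymm (mk_le_mk_of_le inf_le_left)
    (mk_le_mk_iff_exists_open.2 ⟨V, hVo, le_rfl⟩)
  refine Subtype.ext ?_
  rw [coe_smul, ← hL, ← hL', smul_mk]
  refine congrArg mk (LocallyNormal.ext (conj_smul_eq_of_mem_normalizer ?_))
  exact Subgroup.centralizer_le_normalizer _
    (Subgroup.mem_centralizer_iff.2 fun x hx => (hLV x hx).symm)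

theorem exists_mem_rist_ne_one {β : LC G} (hβ : β ≠ ⊥) {V : Subgroup G} (hV : IsOpen (V : Set G)) :
    ∃ x ∈ rist β ⊓ V, x ≠ 1 := by
  obtain ⟨K, hK⟩ := exists_mk β
  obtain ⟨x, hx, hx1⟩ := (Subgroup.bot_or_exists_ne_one _).resolve_left
    fun h => hβ (eq_bot_iff.2 (hK ▸ mk_eq_bot_iff.2 (LocallyNormal.eq_bot_of_inf_eq_bot hV h)))
  exact ⟨x, ⟨le_rist hK hx.1, hx.2⟩, hx1⟩

theorem conj_mem_rist {β : LC G} {g x : G} (hx : x ∈ rist β) : g * x * g⁻¹ ∈ rist (g • β) := by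
  intro δ hδ
  have h : g⁻¹ • δ ⊓ β = ⊥ := by
    rw [← smul_eq_bot_iff (g := g), smul_inf, smul_inv_smul, hδ]
  rw [mul_smul, mul_smul, hx _ h, smul_inv_smul]

/-- `x` fixes the part of `δ` outside `β`, so this part lies below both `δ` and `x • δ`, hence is
zero. -/
theorem le_of_mem_rist {β δ : LC G} {x : G} (hx : x ∈ rist β) (h : δ ⊓ x • δ = ⊥) : δ ≤ β := by
  rw [← disjoint_compl_right_iff, disjoint_iff]
  have h1 : x • (δ ⊓ βᶜ) = δ ⊓ βᶜ := hx _ (by rw [inf_assoc, compl_inf_eq_bot, inf_bot_eq])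
  rw [← le_bot_iff, ← h]
  refine le_inf inf_le_left ?_
  rw [← h1, smul_le_smul_iff]
  exact inf_le_left

end LC

/-! ### Ultrafilters and minimality of the action on `Ω` -/

namespace StoneSpace

theorem mem_smul_iff {g : G} {ω : StoneSpace G} {β : LC G} :
    β ∈ (g • ω).toPFilter ↔ g⁻¹ • β ∈ ω.toPFilter := Iff.rfl

theorem smul_mem_smul_iff {g : G} {ω : StoneSpace G} {β : LC G} :
    g • β ∈ (g • ω).toPFilter ↔ β ∈ ω.toPFilter := by
  rw [mem_smul_iff, inv_smul_smul]

theorem inf_mem {ω : StoneSpace G} {β γ : LC G} (hβ : β ∈ ω.toPFilter) (hγ : γ ∈ ω.toPFilter) :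
    β ⊓ γ ∈ ω.toPFilter := Order.PFilter.inf_mem hβ hγ

theorem mem_of_le {ω : StoneSpace G} {β γ : LC G} (h : β ≤ γ) (hβ : β ∈ ω.toPFilter) :
    γ ∈ ω.toPFilter := Order.PFilter.mem_of_le h hβ

theorem bot_notMem (ω : StoneSpace G) : ⊥ ∉ ω.toPFilter := fun h =>
  ω.proper (Set.eq_univ_of_forall fun _ => mem_of_le bot_le h)

theorem compl_mem_of_notMem {ω : StoneSpace G} {β : LC G} (h : β ∉ ω.toPFilter) :
    βᶜ ∈ ω.toPFilter := by
  by_contra hc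
  -- The filter generated by `ω` and `β`, which is proper because `βᶜ` is not in `ω`.
  let F : Order.PFilter (LC G) :=
    Order.IsPFilter.toPFilter (F := {δ | ∃ γ ∈ ω.toPFilter, γ ⊓ β ≤ δ}) <| Order.IsPFilter.of_def
      (let ⟨γ, hγ⟩ := ω.toPFilter.nonempty; ⟨γ, γ, hγ, inf_le_left⟩)
      (by
        rintro δ ⟨γ, hγ, h⟩ δ' ⟨γ', hγ', h'⟩
        exact ⟨δ ⊓ δ', ⟨γ ⊓ γ', inf_mem hγ hγ', le_inf
          ((inf_le_inf_right _ inf_le_left).trans h) ((inf_le_inf_right _ inf_le_right).trans h')⟩,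
          inf_le_left, inf_le_right⟩)
      (fun h ⟨γ, hγ, hγβ⟩ => ⟨γ, hγ, hγβ.trans h⟩)
  have hF : F = ω.toPFilter := by
    refine ω.maximal F (fun γ hγ => ⟨γ, hγ, inf_le_left⟩) fun hu => ?_
    obtain ⟨γ, hγ, hγβ⟩ : (⊥ : LC G) ∈ (F : Set (LC G)) := hu ▸ Set.mem_univ _
    exact hc (mem_of_le (le_compl_iff_disjoint_right.2 (disjoint_iff_inf_le.2 hγβ)) hγ)
  refine h (hF ▸ ?_)
  obtain ⟨γ, hγ⟩ := ω.toPFilter.nonempty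
  exact ⟨γ, hγ, inf_le_right⟩

theorem notMem_of_compl_mem {ω : StoneSpace G} {β : LC G} (h : βᶜ ∈ ω.toPFilter) :
    β ∉ ω.toPFilter := fun hβ => ω.bot_notMem (by simpa using inf_mem hβ h)

theorem top_mem (ω : StoneSpace G) : ⊤ ∈ ω.toPFilter := by
  obtain ⟨γ, hγ⟩ := ω.toPFilter.nonempty
  exact mem_of_le le_top hγ

theorem eq_of_forall_mem {ω ω' : StoneSpace G}
    (h : ∀ β ∈ ω.toPFilter, β ∈ ω'.toPFilter) : ω = ω' :=
  StoneSpace.ext (ω.maximal ω'.toPFilter h ω'.proper).symm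

/-- Ultrafilters separate an element of `LC(G)` from an ideal that does not contain it. -/
theorem exists_mem_disjoint {I : Order.Ideal (LC G)} {β : LC G} (hβ : β ∉ I) :
    ∃ ω : StoneSpace G, β ∈ ω.toPFilter ∧ ∀ δ ∈ I, δ ∉ ω.toPFilter := by
  obtain ⟨J, hJ, hIJ, hFJ⟩ := DistribLattice.prime_ideal_of_disjoint_filter_ideal
    (F := Order.PFilter.principal β) (I := I)
    (Set.disjoint_left.2 fun γ hγ hγI => hβ (I.lower hγ hγI))
  have hF : ∀ {γ}, γ ∈ hJ.toPrimePair.F ↔ γ ∉ J := by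
    intro γ
    have := hJ.toPrimePair.compl_I_eq_F
    rw [← SetLike.mem_coe, ← this]
    rfl
  refine ⟨⟨hJ.toPrimePair.F, fun h => ?_, fun F' hF' hu => ?_⟩, ?_, fun δ hδ h => ?_⟩
  · have h1 : (⊥ : LC G) ∈ hJ.toPrimePair.F := by
      rw [← SetLike.mem_coe, h]; trivial
    exact hF.1 h1 J.bot_mem
  · refine le_antisymm (fun γ hγ => ?_) hF'
    by_contra hγF
    have hγc : γᶜ ∈ F' := hF' (hF.2 fun h => by
      have h2 := Order.Ideal.sup_mem (not_not.1 (mt hF.2 hγF)) h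
      rw [sup_compl_eq_top] at h2
      exact hJ.toIsProper.top_notMem h2)
    have h0 := Order.PFilter.inf_mem hγ hγc
    rw [inf_compl_eq_bot] at h0
    exact hu (Set.eq_univ_of_forall fun _ => Order.PFilter.mem_of_le bot_le h0)
  · exact hF.2 (Set.disjoint_left.1 hFJ (Order.PFilter.mem_principal.2 le_rfl))
  · exact hF.1 h (hIJ hδ)

theorem exists_mem {β : LC G} (hβ : β ≠ ⊥) : ∃ ω : StoneSpace G, β ∈ ω.toPFilter := by
  obtain ⟨ω, hω, -⟩ := exists_mem_disjoint (I := Order.Ideal.principal ⊥) (β := β)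
    (by rwa [Order.Ideal.mem_principal, le_bot_iff])
  exact ⟨ω, hω⟩

/-- Minimality of the action on the Stone space. -/
theorem exists_smul_mem {β : LC G} (hβ : β ≠ ⊥) (ω : StoneSpace G) :
    ∃ g : G, g • β ∈ ω.toPFilter := by
  obtain ⟨T, hT⟩ := LC.exists_finset_smul_inf_ne_bot hβ
  by_contra! h
  -- The meet of the complements of finitely many translates would be a nonzero element disjoint
  -- from all of them.
  have hmem : T.inf (fun t => (t • β)ᶜ) ∈ ω.toPFilter :=
    Finset.inf_induction (p := (· ∈ ω.toPFilter)) (top_mem ω) (fun _ h _ h' => inf_mem h h')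
      fun t _ => compl_mem_of_notMem (h t)
  obtain ⟨t, ht, h1⟩ := hT _ fun h0 => ω.bot_notMem (h0 ▸ hmem)
  refine h1 (le_bot_iff.1 ?_)
  exact (inf_le_inf_left _ (Finset.inf_le ht)).trans_eq (inf_compl_self _)

end StoneSpace

/-! ### Faithfulness, compressibility and proximality -/

namespace LC

theorem top_ne_bot : (⊤ : LC G) ≠ ⊥ := by
  intro h
  obtain ⟨U, hUc, hUo⟩ := exists_compact_open_subgroup G
  refine ne_bot_of_isOpen hUo (LN.mk_eq_bot_iff (K := .ofOpen U hUc hUo).1 ?_)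
  rw [LN.mk_ofOpen, ← coe_top, h, coe_bot]

/-- If `LC(G)` is nontrivial then `G` acts faithfully on it. -/
theorem exists_smul_ne {β : LC G} (h0 : β ≠ ⊥) (h1 : β ≠ ⊤) {x : G} (hx : x ≠ 1) :
    ∃ γ : LC G, x • γ ≠ γ := by
  by_contra! h
  have hc : IsClosed ((MulAction.toPermHom G (LC G)).ker : Set G) := by
    have : ((MulAction.toPermHom G (LC G)).ker : Set G) =
        ⋂ γ : LC G, (MulAction.stabilizer G γ : Set G) := by
      ext g
      simp [MonoidHom.mem_ker, Equiv.ext_iff]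
    rw [this]
    exact isClosed_iInter fun γ => Subgroup.isClosed_of_isOpen _ (isOpen_stabilizer γ)
  have hb : ∃ g : G, g • β ≠ β := by
    by_contra! hg
    exact (eq_bot_or_eq_top_of_fixed hg).elim h0 h1
  obtain ⟨g, hg⟩ := hb
  have := eq_bot_of_normal_of_isClosed (MonoidHom.normal_ker _) hc (x := g) fun hgk =>
    hg (Equiv.ext_iff.1 hgk β)
  refine hx ((Subgroup.eq_bot_iff_forall _).1 this x ?_)
  exact Equiv.ext h

/-- An element acting nontrivially on `LC(G)` moves some nonzero element off itself. -/
theorem exists_inf_smul_eq_bot {x : G} {γ : LC G} (h : x • γ ≠ γ) :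
    ∃ δ : LC G, δ ≠ ⊥ ∧ δ ⊓ x • δ = ⊥ := by
  by_cases hle : γ ≤ x • γ
  · refine ⟨x • γ ⊓ γᶜ, fun h0 => h (le_antisymm ?_ hle), ?_⟩
    · exact disjoint_compl_right_iff.1 (disjoint_iff.2 h0)
    · rw [smul_inf, smul_compl, ← le_bot_iff, ← inf_compl_self (x • γ)]
      exact inf_le_inf inf_le_left inf_le_right
  · refine ⟨γ ⊓ (x • γ)ᶜ, fun h0 => hle ?_, ?_⟩
    · exact disjoint_compl_right_iff.1 (disjoint_iff.2 h0)
    · rw [smul_inf, ← le_bot_iff, ← compl_inf_self (x • γ)]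
      exact inf_le_inf inf_le_right inf_le_left

/-- There is a compact set avoiding `1` that meets the rigid stabiliser of some translate of every
nonzero element. -/
theorem exists_isCompact_forall_exists_mem_rist :
    ∃ C : Set G, IsCompact C ∧ 1 ∉ C ∧
      ∀ β : LC G, β ≠ ⊥ → ∃ g : G, ∃ x ∈ C, x ∈ rist (g • β) := by
  classical
  have := ClassS.nontrivial (G := G)
  obtain ⟨x₀, hx₀⟩ := exists_ne (1 : G)
  obtain ⟨U, hUc, hUo, hU⟩ := exists_compact_open_subgroup_subset
    (isOpen_compl_singleton.mem_nhds (show (1 : G) ∈ ({x₀}ᶜ : Set G) by simpa using hx₀.symm))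
  obtain ⟨F, -, hF⟩ := exists_finset_closure_eq_top (N := (⊤ : Subgroup G)) (U := U)
    (top_le_iff.1 (Subgroup.le_topologicalClosure _)) hUo
  -- An element of `W` stays in `U` when conjugated by any one generator. If all conjugates of `rist
  -- β` avoid `U \ W`, an element of `rist β ⊓ U` therefore never leaves `U` under conjugation and
  -- falls into the trivial normal core.
  let W : Subgroup G := U ⊓ ⨅ x : (F ∪ F⁻¹ : Finset G), MulAut.conj (x : G) • U
  have hWo : IsOpen (W : Set G) := by
    rw [Subgroup.coe_inf, Subgroup.coe_iInf]
    exact hUo.inter (isOpen_iInter_of_finite fun x => isOpen_conj_smul _ hUo)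
  refine ⟨U \ W, hUc.diff hWo, fun h => h.2 W.one_mem, fun β hβ => ?_⟩
  by_contra! h
  have hW : ∀ g r : G, r ∈ rist β → g⁻¹ * r * g ∈ U → g⁻¹ * r * g ∈ W := by
    intro g r hr hrU
    by_contra hrW
    refine h g⁻¹ _ ⟨hrU, hrW⟩ ?_
    simpa using conj_mem_rist (g := g⁻¹) hr
  have hstep : ∀ g r x : G, r ∈ rist β → g⁻¹ * r * g ∈ U → x ∈ F ∪ F⁻¹ →
      (g * x)⁻¹ * r * (g * x) ∈ U := by
    intro g r x hr hrU hx
    have := mem_conj_smul.1 (Subgroup.mem_iInf.1 (hW g r hr hrU).2 ⟨x, hx⟩)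
    simpa [mul_assoc] using this
  have key : ∀ r ∈ rist β, r ∈ U → ∀ g : G, g⁻¹ * r * g ∈ U := by
    intro r hr hrU g
    have hg : g ∈ Subgroup.closure ((U : Set G) ∪ F) := hF ▸ Subgroup.mem_top g
    induction hg using Subgroup.closure_induction_right with
    | one => simpa using hrU
    | mul_right g _ x hx ih =>
      rcases hx with hx | hx
      · have := U.mul_mem (U.mul_mem (U.inv_mem hx) ih) hx
        simpa [mul_assoc] using this
      · exact hstep g r x hr ih (Finset.mem_union_left _ hx)
    | mul_inv_cancel g _ x hx ih =>
      rcases hx with hx | hx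
      · have := U.mul_mem (U.mul_mem hx ih) (U.inv_mem hx)
        simpa [mul_assoc] using this
      · exact hstep g r x⁻¹ hr ih (Finset.mem_union_right _ (Finset.inv_mem_inv hx))
  have hcore : U.normalCore = ⊥ := eq_bot_of_normal_of_isClosed U.normalCore_normal
    (U.normalCore_isClosed hUc.isClosed) (x := x₀) fun hx => hU (U.normalCore_le hx) rfl
  obtain ⟨r, hr, hr1⟩ := exists_mem_rist_ne_one hβ hUo
  refine hr1 ((Subgroup.eq_bot_iff_forall _).1 hcore r fun g => ?_)
  simpa using key r hr.1 hr.2 g⁻¹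

/-- By minimality a translate of each new element meets the one found so far; the meet goes below
both up to translation. -/
theorem exists_forall_finset_smul_le (S : Finset (LC G)) (hS : ∀ β ∈ S, β ≠ ⊥) :
    ∃ α : LC G, α ≠ ⊥ ∧ ∀ β ∈ S, ∃ g : G, g • α ≤ β := by
  classical
  induction S using Finset.induction_on with
  | empty => exact ⟨⊤, top_ne_bot, by simp⟩
  | insert β S _ ih =>
    simp only [Finset.mem_insert, forall_eq_or_imp] at hS ⊢
    obtain ⟨γ, hγ, hγS⟩ := ih hS.2
    obtain ⟨T, hT⟩ := exists_finset_smul_inf_ne_bot hS.1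
    obtain ⟨t, -, ht⟩ := hT γ hγ
    refine ⟨t • β ⊓ γ, ht, ⟨t⁻¹, ?_⟩, fun δ hδ => ?_⟩
    · rw [smul_inf, inv_smul_smul]
      exact inf_le_left
    · obtain ⟨g, hg⟩ := hγS δ hδ
      exact ⟨g, (LC.smul_le_smul g inf_le_right).trans hg⟩

/-- Some nonzero element of `LC(G)` can be moved below every nonzero element. -/
theorem exists_compressible :
    ∃ α : LC G, α ≠ ⊥ ∧ ∀ β : LC G, β ≠ ⊥ → ∃ g : G, g • α ≤ β := by
  classical
  -- When `LC(G)` is trivial the action is trivial too, so the faithfulness argument below is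
  -- unavailable; there `⊤` works.
  by_cases htriv : ∀ β : LC G, β = ⊥ ∨ β = ⊤
  · exact ⟨⊤, top_ne_bot, fun β hβ => ⟨1, le_top.trans_eq ((htriv β).resolve_left hβ).symm⟩⟩
  push Not at htriv
  obtain ⟨β₀, h0, h1⟩ := htriv
  obtain ⟨C, hC, hC1, hCβ⟩ := exists_isCompact_forall_exists_mem_rist (G := G)
  have hmove : ∀ x ∈ C, ∃ δ : LC G, δ ≠ ⊥ ∧ δ ⊓ x • δ = ⊥ := fun x hx => by
    obtain ⟨γ, hγ⟩ := exists_smul_ne h0 h1 (fun h => hC1 (h ▸ hx) : x ≠ 1)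
    exact exists_inf_smul_eq_bot hγ
  choose! δ hδ hδx using hmove
  -- Because stabilisers are open, finitely many `δ x` serve all of `C`: each `y ∈ C` acts on some
  -- chosen `δ x` exactly as `x` does.
  obtain ⟨t, ht⟩ := hC.elim_finite_subcover
    (fun x : C => {y : G | (x : G)⁻¹ * y ∈ MulAction.stabilizer G (δ x)})
    (fun x => (isOpen_stabilizer (δ x)).preimage (continuous_const_mul _))
    (fun x hx => Set.mem_iUnion.2 ⟨⟨x, hx⟩, by simp⟩)
  obtain ⟨α, hα, hαS⟩ := exists_forall_finset_smul_le (t.image fun x : C => δ x) (by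
    intro β hβ
    obtain ⟨x, -, rfl⟩ := Finset.mem_image.1 hβ
    exact hδ x x.2)
  refine ⟨α, hα, fun β hβ => ?_⟩
  obtain ⟨g, y, hy, hyβ⟩ := hCβ β hβ
  obtain ⟨x, hxt, hx⟩ := Set.mem_iUnion₂.1 (ht hy)
  have hxy : y • δ x = (x : G) • δ x := by
    have : ((x : G)⁻¹ * y) • δ x = δ x := hx
    rwa [mul_smul, inv_smul_eq_iff] at this
  have hle : δ x ≤ g • β := le_of_mem_rist hyβ (hxy ▸ hδx x x.2)
  obtain ⟨h, hh⟩ := hαS _ (Finset.mem_image_of_mem _ hxt)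
  refine ⟨g⁻¹ * h, ?_⟩
  rw [mul_smul]
  exact (LC.smul_le_smul g⁻¹ (hh.trans hle)).trans_eq (inv_smul_smul g β)

theorem smul_eq_of_mem_rist_of_notMem {β : LC G} {x : G} (hx : x ∈ rist β) {ω : StoneSpace G}
    (hω : β ∉ ω.toPFilter) : x • ω = ω := by
  refine (StoneSpace.eq_of_forall_mem fun δ hδ => ?_).symm
  have h1 : x • (δ ⊓ βᶜ) = δ ⊓ βᶜ := hx _ (by rw [inf_assoc, compl_inf_eq_bot, inf_bot_eq])
  have h2 := StoneSpace.inf_mem hδ (StoneSpace.compl_mem_of_notMem hω)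
  rw [← StoneSpace.smul_mem_smul_iff (g := x), h1] at h2
  exact StoneSpace.mem_of_le inf_le_left h2

/-- Any two points of the Stone space lie in a common translate of a nonzero element. -/
theorem exists_smul_mem_and_mem {α : LC G} (hα : α ≠ ⊥) (y z : StoneSpace G) :
    ∃ g : G, g • α ∈ y.toPFilter ∧ g • α ∈ z.toPFilter := by
  by_contra! hD
  -- `D` says that no translate of `α` contains both points. It is invariant under the diagonal
  -- action, and `rist α` also preserves it when acting on one variable: when `α` contains `y` it
  -- cannot contain `z`, so one of the two points is fixed.
  let D : StoneSpace G → StoneSpace G → Prop := fun y z =>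
    ∀ g : G, g • α ∈ y.toPFilter → g • α ∉ z.toPFilter
  have hDg : ∀ (g : G) (y z : StoneSpace G), D (g • y) z ↔ D y (g⁻¹ • z) := by
    intro g y z
    refine ⟨fun h k hk hk' => h (g * k) ?_ ?_, fun h k hk hk' => h (g⁻¹ * k) ?_ ?_⟩
    · rwa [mul_smul, StoneSpace.smul_mem_smul_iff]
    · rwa [StoneSpace.mem_smul_iff, inv_inv, ← mul_smul] at hk'
    · rwa [StoneSpace.mem_smul_iff, ← mul_smul] at hk
    · rwa [StoneSpace.mem_smul_iff, inv_inv, ← mul_smul, mul_inv_cancel_left]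
  have hrist : ∀ f ∈ rist α, ∀ y z, D y z → D (f • y) z := by
    intro f hf y z h
    by_cases hy : α ∈ y.toPFilter
    · have hz : α ∉ z.toPFilter := by
        have := h 1
        rw [one_smul] at this
        exact this hy
      rwa [hDg, smul_eq_of_mem_rist_of_notMem (Subgroup.inv_mem _ hf) hz]
    · rwa [smul_eq_of_mem_rist_of_notMem hf hy]
  let N : Subgroup G :=
    { carrier := {f | ∀ y z, D (f • y) z ↔ D y z}
      one_mem' := by simp
      mul_mem' := by
        intro a b ha hb y z
        rw [mul_smul, ha, hb]
      inv_mem' := by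
        intro a ha y z
        rw [← ha, smul_inv_smul] }
  have hN : N.Normal := ⟨fun f hf g y z => by
    rw [mul_smul, mul_smul, hDg, hf, hDg, inv_inv, smul_inv_smul]⟩
  obtain ⟨x, hx, hx1⟩ := exists_mem_rist_ne_one hα (V := (⊤ : Subgroup G)) isOpen_univ
  have hxN : x ∈ N := fun y z => ⟨fun h => by
    simpa using hrist x⁻¹ (Subgroup.inv_mem _ hx.1) _ _ h, hrist x hx.1 y z⟩
  have hNd := topologicalClosure_eq_top_of_normal (N := N)
    (fun h => hx1 (by rw [h] at hxN; exact hxN))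
  -- `N` is normal and contains `rist α`, so it is dense. Whether a fixed translate of `α` contains
  -- `g • y` is locally constant in `g`, so `D` extends from `N` to `G`, against minimality.
  have hall : ∀ g : G, D (g • y) z := by
    intro g h hg hz
    have hd : g ∈ closure (N : Set G) := by
      rw [← Subgroup.topologicalClosure_coe, hNd]
      trivial
    obtain ⟨n, hn, hnN⟩ := mem_closure_iff.1 hd
      {n | n * g⁻¹ ∈ MulAction.stabilizer G (h • α)}
      ((isOpen_stabilizer (h • α)).preimage (continuous_mul_const _)) (by simp)
    refine (hnN y z).2 hD h ?_ hz
    have h1 : (n * g⁻¹) • h • α = h • α := hn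
    rw [StoneSpace.mem_smul_iff] at hg ⊢
    rw [mul_smul] at h1
    rwa [← h1, inv_smul_smul]
  obtain ⟨g, hg⟩ := StoneSpace.exists_smul_mem hα z
  obtain ⟨h, hh⟩ := StoneSpace.exists_smul_mem hα y
  refine hall (g * h⁻¹) g ?_ hg
  rw [StoneSpace.mem_smul_iff]
  simpa [← mul_smul] using hh

/-! ### Invariant means on the centraliser lattice -/

theorem isLocallyConstant_inv_smul (β : LC G) : IsLocallyConstant fun g : G => g⁻¹ • β := by
  refine (IsLocallyConstant.iff_eventually_eq _).2 fun g => ?_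
  filter_upwards [((isOpen_stabilizer β).preimage (continuous_mul_const g⁻¹)).mem_nhds
    (by simp : g ∈ _)] with x hx
  have h : (x * g⁻¹) • β = β := hx
  rw [inv_smul_eq_iff]
  simpa [mul_smul] using h.symm

/-- A finitely additive probability measure on the Boolean lattice `LC(G)`. -/
structure IsMean (μ : LC G → ℝ) : Prop where
  nonneg : ∀ β, 0 ≤ μ β
  top : μ ⊤ = 1
  sup : ∀ β γ, β ⊓ γ = ⊥ → μ (β ⊔ γ) = μ β + μ γ

namespace IsMean

variable {μ : LC G → ℝ}

theorem bot (hμ : IsMean μ) : μ ⊥ = 0 := by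
  have := hμ.sup ⊥ ⊥ (inf_idem _)
  rw [sup_idem] at this
  linarith

theorem inf_add_inf_compl (hμ : IsMean μ) (β γ : LC G) : μ (β ⊓ γ) + μ (β ⊓ γᶜ) = μ β := by
  rw [← hμ.sup, sup_inf_inf_compl]
  rw [inf_inf_inf_comm, inf_compl_self, inf_bot_eq]

theorem mono (hμ : IsMean μ) {β γ : LC G} (h : β ≤ γ) : μ β ≤ μ γ := by
  have h1 := hμ.inf_add_inf_compl γ β
  rw [inf_eq_right.2 h] at h1
  linarith [hμ.nonneg (γ ⊓ βᶜ)]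

theorem sup_le (hμ : IsMean μ) (β γ : LC G) : μ (β ⊔ γ) ≤ μ β + μ γ := by
  have h1 := hμ.inf_add_inf_compl (β ⊔ γ) β
  rw [inf_eq_right.2 le_sup_left, inf_sup_right, inf_compl_self, bot_sup_eq] at h1
  linarith [hμ.mono (inf_le_left : γ ⊓ βᶜ ≤ γ)]

/-- The ideal of null elements. -/
def nullIdeal (hμ : IsMean μ) : Order.Ideal (LC G) :=
  Order.IsIdeal.toIdeal (I := {β | μ β = 0})
    { IsLowerSet := fun β γ h hβ => le_antisymm ((hμ.mono h).trans_eq hβ) (hμ.nonneg γ)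
      Nonempty := ⟨⊥, hμ.bot⟩
      Directed := fun β hβ γ hγ => ⟨β ⊔ γ, le_antisymm
        ((hμ.sup_le β γ).trans_eq (by rw [hβ, hγ, add_zero])) (hμ.nonneg _),
        le_sup_left, le_sup_right⟩ }

theorem mem_nullIdeal (hμ : IsMean μ) {β : LC G} : β ∈ hμ.nullIdeal ↔ μ β = 0 := Iff.rfl

end IsMean

/-- An amenable subgroup leaves invariant a finitely additive probability measure on `LC(G)`. -/
theorem exists_isMean_of_isAmenable {H : Subgroup G} (hH : IsAmenable H) :
    ∃ μ : LC G → ℝ, IsMean μ ∧ ∀ h ∈ H, ∀ β, μ (h • β) = μ β := by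
  classical
  obtain ⟨ω, -⟩ := StoneSpace.exists_mem (top_ne_bot (G := G))
  obtain ⟨m, hm0, hm1, hm⟩ := hH
  -- The point mass at `ω`. Then `f β` is the indicator of those `h` for which `β` lies in `h • ω`,
  -- so `m` averages point masses along the `H`-orbit of `ω`.
  let χ : LC G → ℝ := fun β => if β ∈ ω.toPFilter then 1 else 0
  have hχ : ∀ β, 0 ≤ χ β ∧ ‖χ β‖ ≤ 1 := by
    intro β
    by_cases h : β ∈ ω.toPFilter <;> simp [χ, h]
  let f : LC G → H →ᵇ ℝ := fun β => BoundedContinuousFunction.ofNormedAddCommGroup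
    (fun h : H => χ ((h : G)⁻¹ • β))
    ((((isLocallyConstant_inv_smul β).comp χ).comp_continuous continuous_subtype_val).continuous)
    1 (fun h => (hχ _).2)
  have hf : ∀ β (h : H), f β h = χ ((h : G)⁻¹ • β) := fun β h => rfl
  refine ⟨fun β => m (f β), ⟨fun β => hm0 _ fun h => (hχ _).1, ?_, fun β γ hβγ => ?_⟩, ?_⟩
  · rw [← hm1]
    congr 1
    ext h
    rw [hf, smul_top]
    simp [χ]
  · rw [← map_add]
    congr 1
    ext h
    rw [BoundedContinuousFunction.add_apply, hf, hf, hf]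
    have hinf : (h : G)⁻¹ • β ⊓ (h : G)⁻¹ • γ = ⊥ := by rw [← smul_inf, hβγ, smul_bot]
    have hsup : (h : G)⁻¹ • (β ⊔ γ) = (h : G)⁻¹ • β ⊔ (h : G)⁻¹ • γ :=
      (smulIso (h : G)⁻¹).map_sup β γ
    rw [hsup]
    generalize (h : G)⁻¹ • β = β' at *
    generalize (h : G)⁻¹ • γ = γ' at *
    by_cases h1 : β' ∈ ω.toPFilter
    · have h2 : γ' ∉ ω.toPFilter := fun h2 => ω.bot_notMem (hinf ▸ StoneSpace.inf_mem h1 h2)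
      simp [χ, h1, h2, StoneSpace.mem_of_le (le_sup_left : β' ≤ β' ⊔ γ') h1]
    · by_cases h2 : γ' ∈ ω.toPFilter
      · simp [χ, h1, h2, StoneSpace.mem_of_le (le_sup_right : γ' ≤ β' ⊔ γ') h2]
      · have h3 : β' ⊔ γ' ∉ ω.toPFilter := by
          refine StoneSpace.notMem_of_compl_mem ?_
          rw [compl_sup]
          exact StoneSpace.inf_mem (StoneSpace.compl_mem_of_notMem h1)
            (StoneSpace.compl_mem_of_notMem h2)
        simp [χ, h1, h2, h3]
  · intro h hh β
    have := hm ⟨h, hh⟩⁻¹ (f β)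
    refine Eq.trans ?_ this
    refine congrArg m ?_
    ext x
    change χ ((x : G)⁻¹ • h • β) = χ (((h : G)⁻¹ * (x : G))⁻¹ • β)
    rw [mul_inv_rev, inv_inv, mul_smul]

/-! ### Cocompact subgroups: fixed points and transitivity -/

section Cocompact

variable {H : Subgroup G}

/-- Invariance under `H` makes `g ↦ p (g⁻¹ • β)` constant on the cosets `gH`; the inverse is what
lets it descend to `G ⧸ H`, with `out` an arbitrary representative. -/
theorem apply_out_inv_smul {X : Sort*} {p : LC G → X} (hp : ∀ h ∈ H, ∀ β, p (h • β) = p β)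
    (β : LC G) (g : G) : p ((g : G ⧸ H).out⁻¹ • β) = p (g⁻¹ • β) := by
  obtain ⟨h, hh⟩ := QuotientGroup.mk_out_eq_mul H g
  rw [hh, mul_inv_rev, mul_smul, hp _ (H.inv_mem h.2)]

theorem continuous_apply_out_inv_smul {X : Type*} [TopologicalSpace X] {p : LC G → X}
    (hp : ∀ h ∈ H, ∀ β, p (h • β) = p β) (β : LC G) :
    Continuous fun q : G ⧸ H => p (q.out⁻¹ • β) := by
  rw [(QuotientGroup.isQuotientMap_mk H).continuous_iff]
  refine (((isLocallyConstant_inv_smul β).comp p).continuous).congr fun g => ?_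
  exact (apply_out_inv_smul hp β g).symm

variable [CompactSpace (G ⧸ H)]

/-- For an invariant function `p` on `LC(G)`, the values `p (g • β)`, `g ∈ G`, have a maximum. -/
theorem exists_forall_apply_smul_le {p : LC G → ℝ} (hp : ∀ h ∈ H, ∀ β, p (h • β) = p β)
    (β : LC G) : ∃ g₀ : G, ∀ g : G, p (g • β) ≤ p (g₀ • β) := by
  obtain ⟨q, -, hq⟩ := isCompact_univ.exists_isMaxOn (s := (Set.univ : Set (G ⧸ H)))
    ⟨((1 : G) : G ⧸ H), trivial⟩ (continuous_apply_out_inv_smul hp β).continuousOn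
  refine ⟨q.out⁻¹, fun g => ?_⟩
  have := hq (Set.mem_univ ((g⁻¹ : G) : G ⧸ H))
  change p _ ≤ p _ at this
  rwa [apply_out_inv_smul hp, inv_inv] at this

/-- An invariant monotone property that holds for a translate of every member of an ultrafilter
holds for a common translate of all members. -/
theorem exists_forall_mem_apply_smul {p : LC G → Prop} (hp : ∀ h ∈ H, ∀ β, p (h • β) = p β)
    (hmono : ∀ β γ, β ≤ γ → p β → p γ) {ω : StoneSpace G}
    (hω : ∀ β ∈ ω.toPFilter, ∃ g : G, p (g • β)) :
    ∃ g : G, ∀ β ∈ ω.toPFilter, p (g • β) := by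
  -- These sets are closed by local constancy and directed because `p` is monotone and `ω` is stable
  -- under meets, so compactness of `G ⧸ H` gives a common point.
  let t : {β : LC G // β ∈ ω.toPFilter} → Set (G ⧸ H) := fun β => {q | p (q.out⁻¹ • β.1)}
  have hcl : ∀ β, IsClosed (t β) := fun β => by
    rw [← (QuotientGroup.isQuotientMap_mk H).isClosed_preimage]
    have : (QuotientGroup.mk : G → G ⧸ H) ⁻¹' t β = (fun g : G => g⁻¹ • β.1) ⁻¹' {γ | p γ} := by
      ext g
      exact iff_of_eq (apply_out_inv_smul hp β.1 g)
    rw [this]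
    exact ⟨(isLocallyConstant_inv_smul β.1) {γ | p γ}ᶜ⟩
  have : Nonempty {β : LC G // β ∈ ω.toPFilter} := ⟨⟨⊤, ω.top_mem⟩⟩
  obtain ⟨q, hq⟩ := IsCompact.nonempty_iInter_of_directed_nonempty_isCompact_isClosed t
    (fun β γ => ⟨⟨β.1 ⊓ γ.1, StoneSpace.inf_mem β.2 γ.2⟩,
      fun q hq => hmono _ _ (LC.smul_le_smul _ inf_le_left) hq,
      fun q hq => hmono _ _ (LC.smul_le_smul _ inf_le_right) hq⟩)
    (fun β => by
      obtain ⟨g, hg⟩ := hω β.1 β.2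
      refine ⟨((g⁻¹ : G) : G ⧸ H), ?_⟩
      change p _
      rwa [apply_out_inv_smul hp, inv_inv])
    (fun β => (hcl β).isCompact) hcl
  exact ⟨q.out⁻¹, fun β hβ => Set.mem_iInter.1 hq ⟨β, hβ⟩⟩

/-- A cocompact subgroup leaving a mean on `LC(G)` invariant fixes a point of the Stone space. -/
theorem exists_fixed_point_of_isMean {μ : LC G → ℝ} (hμ : IsMean μ)
    (hH : ∀ h ∈ H, ∀ β, μ (h • β) = μ β) : ∃ ω : StoneSpace G, ∀ h ∈ H, h • ω = ω := by
  obtain ⟨α, hα, hcomp⟩ := exists_compressible (G := G)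
  obtain ⟨g₀, hg₀⟩ := exists_forall_apply_smul_le hH α
  obtain ⟨ζ, -⟩ := StoneSpace.exists_mem hα
  -- Each `β ∈ ζ` lies above a translate of `α`, so some translate of `β` lies above `g₀ • α` and
  -- has at least the maximal mass. Compactness supplies one `g` for all `β`, and `g • ζ` is the
  -- point where the mass concentrates.
  obtain ⟨g, hg⟩ := exists_forall_mem_apply_smul (H := H) (p := fun β => μ (g₀ • α) ≤ μ β)
    (fun h hh β => by rw [hH h hh]) (fun β γ h h' => h'.trans (hμ.mono h)) (ω := ζ) (by
      intro β hβ
      obtain ⟨k, hk⟩ := hcomp β fun h => ζ.bot_notMem (h ▸ hβ)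
      refine ⟨g₀ * k⁻¹, hμ.mono ?_⟩
      rw [mul_smul]
      exact LC.smul_le_smul _ (by simpa using LC.smul_le_smul k⁻¹ hk))
  have hξ : ∀ β ∈ (g • ζ).toPFilter, μ (g₀ • α) ≤ μ β := fun β hβ => by
    simpa using hg _ hβ
  -- Here `y` is a point of the support of `μ` inside `β`. In a translate of `α` containing both
  -- points, the maximal mass is used up outside `β`.
  have hnull : ∀ β ∉ (g • ζ).toPFilter, μ β = 0 := by
    intro β hβ
    by_contra h0
    obtain ⟨y, hyβ, hy⟩ := StoneSpace.exists_mem_disjoint (I := hμ.nullIdeal) (β := β) h0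
    obtain ⟨k, hk, hky⟩ := exists_smul_mem_and_mem hα (g • ζ) y
    refine hy (k • α ⊓ β) (hμ.mem_nullIdeal.2 ?_) (StoneSpace.inf_mem hky hyβ)
    have h1 := hμ.inf_add_inf_compl (k • α) β
    have h2 := hξ _ (StoneSpace.inf_mem hk (StoneSpace.compl_mem_of_notMem hβ))
    have h3 := hg₀ k
    linarith [hμ.nonneg (k • α ⊓ β)]
  refine ⟨g • ζ, fun h hh => (StoneSpace.eq_of_forall_mem fun β hβ => ?_).symm⟩
  rw [StoneSpace.mem_smul_iff]
  by_contra hβ'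
  -- If `h⁻¹ • β` missed the point, invariance would make `β` null, and `βᶜ` is null as well,
  -- contradicting total mass `1`.
  have h1 := hnull _ hβ'
  rw [hH _ (H.inv_mem hh)] at h1
  have h2 := hnull βᶜ (StoneSpace.notMem_of_compl_mem (by rwa [compl_compl]))
  have h3 := hμ.inf_add_inf_compl ⊤ β
  rw [top_inf_eq, top_inf_eq, h1, h2, hμ.top] at h3
  norm_num at h3

/-- If a cocompact subgroup of `G` fixes a point of the Stone space, then `G` acts transitively. -/
theorem isPretransitive_of_fixed_point {ω : StoneSpace G} (hω : ∀ h ∈ H, h • ω = ω) :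
    MulAction.IsPretransitive G (StoneSpace G) := by
  have key : ∀ ζ : StoneSpace G, ∃ g : G, g • ω = ζ := by
    intro ζ
    obtain ⟨g, hg⟩ := exists_forall_mem_apply_smul (H := H) (p := fun β => β ∈ ω.toPFilter)
      (fun h hh β => by
        have := hω _ hh
        conv_lhs => rw [← this]
        exact propext StoneSpace.smul_mem_smul_iff)
      (fun β γ h h' => StoneSpace.mem_of_le h h') (ω := ζ)
      (fun β hβ => StoneSpace.exists_smul_mem (fun h => ζ.bot_notMem (h ▸ hβ)) ω)
    refine ⟨g⁻¹, (StoneSpace.eq_of_forall_mem fun β hβ => ?_).symm⟩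
    rw [StoneSpace.mem_smul_iff, inv_inv]
    exact hg β hβ
  refine ⟨fun y z => ?_⟩
  obtain ⟨a, rfl⟩ := key y
  obtain ⟨b, rfl⟩ := key z
  exact ⟨b * a⁻¹, by rw [mul_smul, inv_smul_smul]⟩

end Cocompact

end LC

/-! ### Conclusion -/

theorem IsClosedCocompactAmenable.exists_fixed_point {H : Subgroup G}
    (hH : IsClosedCocompactAmenable H) : ∃ ω : StoneSpace G, ∀ h ∈ H, h • ω = ω := by
  obtain ⟨μ, hμ, hinv⟩ := LC.exists_isMean_of_isAmenable hH.amenable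
  have := hH.cocompact
  exact LC.exists_fixed_point_of_isMean hμ hinv

/-- Amenability is invariant under isomorphisms of topological groups. -/
theorem IsAmenable.of_continuousMulEquiv {H K : Type u} [Group H] [TopologicalSpace H]
    [IsTopologicalGroup H] [Group K] [TopologicalSpace K] [IsTopologicalGroup K] (e : H ≃ₜ* K)
    (h : IsAmenable H) : IsAmenable K := by
  obtain ⟨m, hm0, hm1, hm⟩ := h
  let c : C(H, K) := ⟨e, e.continuous⟩
  let φ : (K →ᵇ ℝ) →ₗ[ℝ] (H →ᵇ ℝ) :=
    { toFun := fun f => f.compContinuous c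
      map_add' := fun _ _ => rfl
      map_smul' := fun _ _ => rfl }
  refine ⟨m ∘ₗ φ, fun f hf => hm0 _ fun x => hf _, hm1, fun k f => ?_⟩
  rw [LinearMap.comp_apply, LinearMap.comp_apply, ← hm (e.symm k) (φ f)]
  congr 1
  ext x
  change f (k * e x) = f (e (e.symm k * x))
  rw [map_mul e, e.apply_symm_apply]

theorem isClosedCocompactAmenable_top (h : IsAmenable G) :
    IsClosedCocompactAmenable (⊤ : Subgroup G) where
  isClosed := isClosed_univ
  cocompact := by
    have : Subsingleton (G ⧸ (⊤ : Subgroup G)) := QuotientGroup.subsingleton_quotient_top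
    infer_instance
  amenable := by
    refine h.of_continuousMulEquiv (ContinuousMulEquiv.mk Subgroup.topEquiv.symm ?_ ?_)
    · exact Continuous.subtype_mk continuous_id _
    · exact continuous_subtype_val

/-- If the centraliser lattice is nontrivial, then `G` has no fixed point in its Stone space. -/
theorem StoneSpace.exists_smul_ne {β : LC G} (h0 : β ≠ ⊥) (h1 : β ≠ ⊤) (ω : StoneSpace G) :
    ∃ g : G, g • ω ≠ ω := by
  by_contra! h
  -- Minimality puts some translate of `γ` in `ω`, and a globally fixed `ω` then contains `γ`
  -- itself.
  have key : ∀ γ : LC G, γ ≠ ⊥ → γ ∈ ω.toPFilter := fun γ hγ => by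
    obtain ⟨g, hg⟩ := StoneSpace.exists_smul_mem hγ ω
    rw [← h g] at hg
    exact StoneSpace.smul_mem_smul_iff.1 hg
  exact StoneSpace.notMem_of_compl_mem (key βᶜ (compl_eq_bot.not.2 h1)) (key β h0)

end TDLC

theorem mainTheorem6 {G : Type*} [Group G] [TopologicalSpace G] [TDLC.ClassS G] :
    (∀ H : Subgroup G, TDLC.IsClosedCocompactAmenable H →
      ∃ ω : TDLC.StoneSpace G, ∀ h ∈ H, h • ω = ω) ∧
    (TDLC.LC G ≠ {⊥, ⊤} → ¬ TDLC.IsAmenable G) ∧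
    ((∃ H : Subgroup G, TDLC.IsClosedCocompactAmenable H) →
      MulAction.IsPretransitive G (TDLC.StoneSpace G)) := by
  refine ⟨fun H hH => hH.exists_fixed_point, fun hLC hG => ?_, ?_⟩
  · obtain ⟨ω, hω⟩ := (TDLC.isClosedCocompactAmenable_top hG).exists_fixed_point
    have hβ : ∃ β : TDLC.LC G, β ≠ ⊥ ∧ β ≠ ⊤ := by
      by_contra! h
      refine hLC (Set.Subset.antisymm (fun β hβ => ?_) ?_)
      · by_cases h0 : (⟨β, hβ⟩ : TDLC.LC G) = ⊥
        · exact Or.inl (congrArg Subtype.val h0)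
        · exact Or.inr (congrArg Subtype.val (h _ h0))
      · rintro _ (rfl | rfl)
        · exact (⊥ : TDLC.LC G).2
        · exact (⊤ : TDLC.LC G).2
    obtain ⟨β, h0, h1⟩ := hβ
    obtain ⟨g, hg⟩ := TDLC.StoneSpace.exists_smul_ne h0 h1 ω
    exact hg (hω g (Subgroup.mem_top g))
  · rintro ⟨H, hH⟩
    obtain ⟨ω, hω⟩ := hH.exists_fixed_point
    have := hH.cocompact
    exact TDLC.LC.isPretransitive_of_fixed_point hω
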